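/- Setting. A Lévy basis on $\mathbb{R}^2$ is a family $L=\{L(B)\}$ of real random variables on a probability space $(\Omega,\mathcal F,\mathbb P)$, indexed by the Borel sets $B\subseteq\mathbb{R}^2$ with $\mathrm{Leb}(B)<\infty$, such that (i) for pairwise disjoint $B_1,B_2,\dots$ with union $B$, all in the index family, $L(B)=\sum_i L(B_i)$ almost surely; (ii) every $L(B)$ is infinitely divisible; (iii) $L(B)$ and $L(B')$ are independent whenever $B\cap B'=\emptyset$. It is homogeneous with characteristic triplet $(\gamma,b,\nu)$, where $\gamma\in\mathbb{R}$, $b\ge 0$ and $\nu$ is a Lévy measure (that is, $\nu(\{0\})=0$ and $\int_{\mathbb{R}\setminus\{0\}}(1\wedge|x|^2)\,\nu(\mathrm dx)<\infty$), if $\mathbb{E}(e^{izL(B)})=\exp(\mathrm{Leb}(B)\psi(z))$ for all such $B$ and all $z\in\mathbb{R}$, with $$\psi(z)=i\gamma z-\tfrac12 b^2z^2+\int_{\mathbb{R}\setminus\{0\}}\bigl(e^{izx}-1-izx\mathbf 1_{|x|\le 1}\bigr)\nu(\mathrm dx).$$ Its Lévy seed $L'$ is a random variable with characteristic function $e^{\psi}$.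 Let $L$ be a homogeneous Lévy basis on $\mathbb{R}^2$ whose seed satisfies $\mathrm{Var}(L')=1$ and $\mathbb{E}(|L'|^4)<\infty$. Let $a:[0,\infty)\to[0,\infty)$ be continuous, non-increasing and integrable, let $A=\{(r,y): r\le 0,\ 0\le y\le a(-r)\}$ and $A_t=A+(t,0)$, and let $X_t=L(A_t)$, $t\in\mathbb{R}$, be the associated trawl process. Let $\Delta_n>0$ with $\Delta_n\to0$ and $n\Delta_n\to\infty$ as $n\to\infty$. From the observations $X_0,X_{\Delta_n},\dots,X_{(n-1)\Delta_n}$ define $\bar X_n=\frac1n\sum_{k=0}^{n-1}X_{k\Delta_n}$, $$\hat\Gamma_l=\frac1n\sum_{k=0}^{n-1-l}(X_{(l+k)\Delta_n}-\bar X_n)(X_{k\Delta_n}-\bar X_n)\quad(0\le l\le n-1),\qquad \hat\Gamma_n=0,$$ and the estimator of $a$ $$\hat a(0)=\frac{1}{2\Delta_n n}\sum_{k=0}^{n-2}(X_{(k+1)\Delta_n}-X_{k\Delta_n})^2,\qquad \hat a(t)=-\Delta_n^{-1}\bigl[\hat\Gamma_{l+1}-\hat\Gamma_l\bigr]\ \text{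 if } t>0,\ l\Delta_n\le t<(l+1)\Delta_n .$$ Claim. For every $h>0$, as $n\to\infty$, $$\sum_{l=0}^{n-1}\hat a(l\Delta_n)\Delta_n\ \xrightarrow{\ \mathbb P\ }\ \mathrm{Leb}(A),\qquad \sum_{\substack{0\le l\le n-1\\ l\Delta_n\ge h}}\hat a(l\Delta_n)\Delta_n\ \xrightarrow{\ \mathbb P\ }\ \mathrm{Leb}(A\cap A_h),\qquad \sum_{\substack{0\le l\le n-1\\ l\Delta_n<h}}\hat a(l\Delta_n)\Delta_n\ \xrightarrow{\ \mathbb P\ }\ \mathrm{Leb}(A\setminus A_h).$$ -/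

import Mathlib

open MeasureTheory ProbabilityTheory Filter Topology
open scoped BigOperators

noncomputable section

/-- A probability law on `ℝ` is infinitely divisible if for every `n ≥ 1` it is the law of a sum
of `n` independent identically distributed random variables. -/
def IsInfinitelyDivisible (m : Measure ℝ) : Prop :=
  ∀ n : ℕ, 1 ≤ n → ∃ r : Measure ℝ, IsProbabilityMeasure r ∧
    m = (Measure.pi (fun _ : Fin n => r)).map (fun x => ∑ i, x i)

/-- The sets in the domain of a random measure with control measure `m`. -/
def FiniteBorel {E : Type*} [MeasurableSpace E] (m : Measure E) (A : Set E) : Prop :=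
  MeasurableSet A ∧ m A < ⊤

/-- A Lévy basis: an infinitely divisible, independently scattered random measure, indexed by the
measurable sets of finite `m`-measure (the values of `L` on other sets play no role).
The series in `additive` converges almost surely as a sequence of partial sums; for a
Gaussian basis, say, it need not converge absolutely. -/
structure IsLevyBasis {E Ω : Type*} [MeasurableSpace E] [MeasurableSpace Ω] (m : Measure E)
    (P : Measure Ω) (L : Set E → Ω → ℝ) : Prop where
  measurable : ∀ A, FiniteBorel m A → Measurable (L A)
  additive : ∀ A : ℕ → Set E, (∀ i, FiniteBorel m (A i)) → FiniteBorel m (⋃ i, A i) →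
    Pairwise (fun i j => Disjoint (A i) (A j)) →
    ∀ᵐ ω ∂P, Tendsto (fun N : ℕ => ∑ i ∈ Finset.range N, L (A i) ω) atTop
      (𝓝 (L (⋃ i, A i) ω))
  infinitelyDivisible : ∀ A, FiniteBorel m A → IsInfinitelyDivisible (P.map (L A))
  indep : ∀ A B, FiniteBorel m A → FiniteBorel m B → Disjoint A B → IndepFun (L A) (L B) P

/-- `ν` is a Lévy measure on `ℝ`. -/
def IsLevyMeasure (ν : Measure ℝ) : Prop :=
  ν {0} = 0 ∧ ∫⁻ x in {0}ᶜ, ENNReal.ofReal (min 1 (|x| ^ 2)) ∂ν < ⊤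

/-- The characteristic exponent `ψ` of the triplet `(γ, b, ν)`. -/
def charExponent (γ b : ℝ) (ν : Measure ℝ) (z : ℝ) : ℂ :=
  Complex.I * γ * z - (1 / 2 : ℂ) * (b : ℂ) ^ 2 * (z : ℂ) ^ 2
    + ∫ x in {0}ᶜ, (Complex.exp (Complex.I * z * x) - 1
        - {y : ℝ | |y| ≤ 1}.indicator (fun y : ℝ => Complex.I * z * y) x) ∂ν

/-- A homogeneous Lévy basis on `ℝ²` with characteristic triplet `(γ, b, ν)`: its control measure
is Lebesgue measure and the characteristic function of `L(A)` is `z ↦ exp (Leb(A) ψ(z))`. -/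
structure IsHomogeneousLevyBasis {Ω : Type*} [MeasurableSpace Ω] (γ b : ℝ) (ν : Measure ℝ)
    (P : Measure Ω) (L : Set (ℝ × ℝ) → Ω → ℝ) : Prop where
  isLevyBasis : IsLevyBasis (volume : Measure (ℝ × ℝ)) P L
  charFun_eq : ∀ A : Set (ℝ × ℝ), FiniteBorel volume A → ∀ z : ℝ,
    charFun (P.map (L A)) z = Complex.exp ((volume.real A : ℂ) * charExponent γ b ν z)

/-- `L'` is a Lévy seed for the triplet `(γ, b, ν)`: a random variable with characteristic
function `exp ψ`. -/
structure IsLevySeed {Ω' : Type*} [MeasurableSpace Ω'] (γ b : ℝ) (ν : Measure ℝ)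
    (P' : Measure Ω') (L' : Ω' → ℝ) : Prop where
  measurable : Measurable L'
  charFun_eq : ∀ z : ℝ, charFun (P'.map L') z = Complex.exp (charExponent γ b ν z)

/-- A trawl function `a : [0, ∞) → [0, ∞)`; the values of `a` at negative reals play no role. -/
structure IsTrawlFunction (a : ℝ → ℝ) : Prop where
  nonneg : ∀ s, 0 ≤ s → 0 ≤ a s
  continuousOn : ContinuousOn a (Set.Ici 0)
  antitoneOn : AntitoneOn a (Set.Ici 0)
  integrableOn : IntegrableOn a (Set.Ici 0) volume

/-- The trawl set `A`. -/
def trawlSet (a : ℝ → ℝ) : Set (ℝ × ℝ) :=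
  {p | p.1 ≤ 0 ∧ 0 ≤ p.2 ∧ p.2 ≤ a (-p.1)}

/-- The shifted trawl set `A_t = A + (t, 0)`. -/
def trawlSetAt (a : ℝ → ℝ) (t : ℝ) : Set (ℝ × ℝ) :=
  (fun p : ℝ × ℝ => p + (t, 0)) '' trawlSet a

/-- The trawl process `X_t = L(A_t)`. -/
def trawlProcess {Ω : Type*} (L : Set (ℝ × ℝ) → Ω → ℝ) (a : ℝ → ℝ) (t : ℝ) (ω : Ω) : ℝ :=
  L (trawlSetAt a t) ω

/-! Statistics of the `n` equidistant observations `X_0, X_Δ, …, X_{(n-1)Δ}` of a path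
`X : ℝ → ℝ`. -/

/-- The sample mean. -/
def sampleMean (X : ℝ → ℝ) (Δ : ℝ) (n : ℕ) : ℝ :=
  (1 / (n : ℝ)) * ∑ k ∈ Finset.range n, X (k * Δ)

/-- The sample autocovariance at lag `l`; the sum is over `0 ≤ k ≤ n - 1 - l`, and it is empty
for `l ≥ n`. -/
def sampleAutocov (X : ℝ → ℝ) (Δ : ℝ) (n l : ℕ) : ℝ :=
  (1 / (n : ℝ)) * ∑ k ∈ Finset.range (n - l),
    (X (((l + k : ℕ) : ℝ) * Δ) - sampleMean X Δ n) * (X (k * Δ) - sampleMean X Δ n)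

/-- The estimator `â(t)` of the trawl function at `t ≥ 0`; the sum in the first case is over
`0 ≤ k ≤ n - 2`. -/
def trawlEstimator (X : ℝ → ℝ) (Δ : ℝ) (n : ℕ) (t : ℝ) : ℝ :=
  if t = 0 then
    (1 / (2 * Δ * n)) * ∑ k ∈ Finset.range (n - 1), (X (((k + 1 : ℕ) : ℝ) * Δ) - X (k * Δ)) ^ 2
  else
    -Δ⁻¹ * (sampleAutocov X Δ n (⌊t / Δ⌋₊ + 1) - sampleAutocov X Δ n ⌊t / Δ⌋₊)

/-- The estimator of `Leb(A)`. -/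
def lebEstimator (X : ℝ → ℝ) (Δ : ℝ) (n : ℕ) : ℝ :=
  ∑ l ∈ Finset.range n, trawlEstimator X Δ n (l * Δ) * Δ

open Classical in
/-- The estimator of `Leb(A ∩ A_h)`. -/
def lebInterEstimator (X : ℝ → ℝ) (Δ : ℝ) (n : ℕ) (h : ℝ) : ℝ :=
  ∑ l ∈ (Finset.range n).filter (fun l : ℕ => h ≤ l * Δ), trawlEstimator X Δ n (l * Δ) * Δ

open Classical in
/-- The estimator of `Leb(A \ A_h)`. -/
def lebDiffEstimator (X : ℝ → ℝ) (Δ : ℝ) (n : ℕ) (h : ℝ) : ℝ :=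
  ∑ l ∈ (Finset.range n).filter (fun l : ℕ => l * Δ < h), trawlEstimator X Δ n (l * Δ) * Δ

end

/-! The sums of the estimator telescope. Since `â(lΔ)Δ` is `Γ̂_l - Γ̂_{l+1}` for `l ≥ 1` and `Γ̂_n =
0`, the sum over `lΔ ≥ h` is the single autocovariance at lag `⌈h/Δ⌉`, and the full sum is `Γ̂_1`
plus a multiple of the realised quadratic variation. The third sum is the difference of these two.

Write `G(u) = Leb(A ∩ A_u)`. Each squared increment has mean `2(G(0) - G(Δ))`, so the quadratic
variation term tends to `0` in `L¹`. It remains to see that `Γ̂_l → G(h)` in probability when `lΔ`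
decreases to `h` (`tendstoInMeasure_sampleAutocov`); this is used at `⌈h/Δ⌉` and, with limit `0`, at
lag `1`.

That limit is a weak law for the centred process and for its lagged products
(`tendstoInMeasure_average`). Cutting each trawl set at depth `T` changes the summands little in
`L¹`, uniformly in the index, because the tail of `A` has small area. The cut summands are
uncorrelated beyond a fixed time lag, so the average of `n` of them has variance of order `1/(nΔ)`,
which vanishes.

The moment inputs are collected in `IsCenteredNoise`. Independence is assumed only between values at
two disjoint sets, so products of two values are first written as combinations of squares of single
values (`mul_ae_eq`); this gives both the covariance and the decorrelation of products. -/

/-! ### Two tools for moments: independent summands and additive functions -/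

theorem MeasureTheory.MemLp.of_indepFun_add_left {Ω : Type*} [MeasurableSpace Ω] {P : Measure Ω}
    [IsProbabilityMeasure P] {X Y : Ω → ℝ} (hX : Measurable X) (hY : Measurable Y)
    (h : IndepFun X Y P) (hS : MemLp (X + Y) 4 P) : MemLp X 4 P := by
  have hμX : IsProbabilityMeasure (P.map X) := Measure.isProbabilityMeasure_map hX.aemeasurable
  have hμY : IsProbabilityMeasure (P.map Y) := Measure.isProbabilityMeasure_map hY.aemeasurable
  have h1 : Integrable (fun ω => ‖(X + Y) ω‖ ^ (4 : ℕ)) P := hS.integrable_norm_pow (by norm_num)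
  have h2 : Integrable (fun p : ℝ × ℝ => ‖p.1 + p.2‖ ^ (4 : ℕ)) ((P.map X).prod (P.map Y)) := by
    rw [← (indepFun_iff_map_prod_eq_prod_map_map hX.aemeasurable hY.aemeasurable).1 h]
    rw [integrable_map_measure (by fun_prop) (by fun_prop)]
    exact h1
  -- By Fubini almost every section is integrable; a single `y` suffices, since a constant can be
  -- subtracted in `L⁴`.
  obtain ⟨y, hy⟩ := h2.prod_left_ae.exists
  have h3 : MemLp (fun x : ℝ => x + y) 4 (P.map X) := by
    rw [← integrable_norm_rpow_iff (by fun_prop) (by norm_num) (by norm_num)]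
    simpa using hy
  have h4 : MemLp (fun x : ℝ => x) 4 (P.map X) := by
    have := h3.sub (memLp_const y)
    refine this.ae_eq (ae_of_all _ fun x => ?_)
    simp
  exact (memLp_map_measure_iff (by fun_prop) hX.aemeasurable).1 h4

/-- A function additive and nonnegative on the half-line is linear. -/
theorem eq_mul_of_additive_of_nonneg {f : ℝ → ℝ} (h0 : ∀ v, 0 ≤ v → 0 ≤ f v)
    (hadd : ∀ u v, 0 ≤ u → 0 ≤ v → f (u + v) = f u + f v) (h1 : f 1 = 1) {v : ℝ} (hv : 0 ≤ v) :
    f v = v := by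
  have hmono : ∀ u w, 0 ≤ u → u ≤ w → f u ≤ f w := fun u w hu huw => by
    have := hadd u (w - u) hu (by linarith)
    have h2 := h0 (w - u) (by linarith)
    rw [add_sub_cancel] at this
    linarith
  have hz : f 0 = 0 := by have := hadd 0 0 le_rfl le_rfl; simp at this; exact this
  have hn : ∀ (n : ℕ) u, 0 ≤ u → f (n * u) = n * f u := fun n u hu => by
    induction n with
    | zero => simp [hz]
    | succ k ih =>
      have := hadd (k * u) u (by positivity) hu
      push_cast
      rw [add_mul, one_mul, this, ih]; ring
  have hnat : ∀ n : ℕ, f n = n := fun n => by simpa [h1] using hn n 1 zero_le_one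
  -- Both `n * v` and `f (n * v) = n * f v` lie between the same two consecutive integers, as `f` is
  -- monotone and fixes the integers.
  have hbound : ∀ n : ℕ, n * |f v - v| ≤ 1 := fun n => by
    have hnv : 0 ≤ (n : ℝ) * v := by positivity
    have e1 := hmono _ _ (Nat.cast_nonneg _) (Nat.floor_le hnv)
    have e2 := hmono _ _ hnv (Nat.lt_floor_add_one ((n : ℝ) * v)).le
    have e3 := Nat.floor_le hnv
    have e4 := Nat.lt_floor_add_one ((n : ℝ) * v)
    rw [hnat, hn n v hv] at e1
    have e5 : f ((⌊(n : ℝ) * v⌋₊ : ℝ) + 1) = (⌊(n : ℝ) * v⌋₊ : ℝ) + 1 := by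
      simpa using hnat (⌊(n : ℝ) * v⌋₊ + 1)
    rw [e5, hn n v hv] at e2
    rw [← abs_of_nonneg (Nat.cast_nonneg (α := ℝ) n), ← abs_mul, abs_le, mul_sub]
    constructor <;> linarith
  by_contra hne
  have hpos : 0 < |f v - v| := abs_pos.2 (sub_ne_zero.2 hne)
  obtain ⟨n, hn⟩ := exists_nat_gt (1 / |f v - v|)
  have := hbound n
  rw [div_lt_iff₀ hpos] at hn
  linarith

/-! ### Sets of finite measure, centred noise and finite additivity -/

theorem FiniteBorel.union {E : Type*} [MeasurableSpace E] {m : Measure E} {A B : Set E}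
    (hA : FiniteBorel m A) (hB : FiniteBorel m B) : FiniteBorel m (A ∪ B) :=
  ⟨hA.1.union hB.1, (measure_union_le A B).trans_lt (ENNReal.add_lt_top.2 ⟨hA.2, hB.2⟩)⟩

theorem FiniteBorel.mono {E : Type*} [MeasurableSpace E] {m : Measure E} {A B : Set E}
    (hA : FiniteBorel m A) (hB : MeasurableSet B) (h : B ⊆ A) : FiniteBorel m B :=
  ⟨hB, (measure_mono h).trans_lt hA.2⟩

theorem FiniteBorel.inter {E : Type*} [MeasurableSpace E] {m : Measure E} {A B : Set E}
    (hA : FiniteBorel m A) (hB : FiniteBorel m B) : FiniteBorel m (A ∩ B) :=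
  hA.mono (hA.1.inter hB.1) Set.inter_subset_left

theorem FiniteBorel.diff {E : Type*} [MeasurableSpace E] {m : Measure E} {A B : Set E}
    (hA : FiniteBorel m A) (hB : FiniteBorel m B) : FiniteBorel m (A \ B) :=
  hA.mono (hA.1.diff hB.1) Set.sdiff_subset

theorem FiniteBorel.empty {E : Type*} [MeasurableSpace E] (m : Measure E) :
    FiniteBorel m ∅ := ⟨.empty, by simp⟩

/-- A centred random measure with finite fourth moments, independent on disjoint sets, with
variance the control measure, whose fourth moment at a set depends only on the size of the set. -/
structure IsCenteredNoise {E Ω : Type*} [MeasurableSpace E] [MeasurableSpace Ω] (m : Measure E)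
    (P : Measure Ω) (M : Set E → Ω → ℝ) : Prop where
  memLp : ∀ A, FiniteBorel m A → MemLp (M A) 4 P
  union : ∀ A B, FiniteBorel m A → FiniteBorel m B → Disjoint A B →
    M (A ∪ B) =ᵐ[P] M A + M B
  indep : ∀ A B, FiniteBorel m A → FiniteBorel m B → Disjoint A B → IndepFun (M A) (M B) P
  integral_eq_zero : ∀ A, FiniteBorel m A → ∫ ω, M A ω ∂P = 0
  integral_sq : ∀ A, FiniteBorel m A → ∫ ω, M A ω ^ 2 ∂P = m.real A
  integral_pow_four : ∀ A B, FiniteBorel m A → FiniteBorel m B → m.real A = m.real B →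
    ∫ ω, M A ω ^ 4 ∂P = ∫ ω, M B ω ^ 4 ∂P

theorem IsLevyBasis.union {E Ω : Type*} [MeasurableSpace E] [MeasurableSpace Ω] {m : Measure E}
    {P : Measure Ω} {L : Set E → Ω → ℝ} (hL : IsLevyBasis m P L) {A B : Set E}
    (hA : FiniteBorel m A) (hB : FiniteBorel m B) (h : Disjoint A B) :
    L (A ∪ B) =ᵐ[P] L A + L B := by
  -- For the constant sequence `∅` the partial sums `N * L ∅` converge, so their constant increment
  -- `L ∅` is zero.
  have hzero : L ∅ =ᵐ[P] 0 := by
    have h1 := hL.additive (fun _ => ∅) (fun _ => .empty m) (by simpa using .empty m)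
      (fun i j _ => by simp)
    filter_upwards [h1] with ω hω
    simp only [Finset.sum_const, Finset.card_range, nsmul_eq_mul, Set.iUnion_empty] at hω
    have h2 := (tendsto_add_atTop_iff_nat 1).2 hω
    have h3 := h2.sub hω
    have h4 : (fun x : ℕ => ((x + 1 : ℕ) : ℝ) * L ∅ ω - (x : ℝ) * L ∅ ω) = fun _ => L ∅ ω := by
      ext x; push_cast; ring
    rw [h4] at h3
    simpa using tendsto_nhds_unique tendsto_const_nhds h3
  let S : ℕ → Set E := fun i => if i = 0 then A else if i = 1 then B else ∅
  have hU : ⋃ i, S i = A ∪ B := by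
    ext x
    simp only [Set.mem_iUnion, Set.mem_union, S]
    constructor
    · rintro ⟨i, hi⟩
      split_ifs at hi
      · exact .inl hi
      · exact .inr hi
      · exact hi.elim
    · rintro (hx | hx)
      · exact ⟨0, by simpa using hx⟩
      · exact ⟨1, by simpa using hx⟩
  have h1 := hL.additive S
    (fun i => by simp only [S]; split_ifs <;> [exact hA; exact hB; exact .empty m])
    (by rw [hU]; exact hA.union hB)
    (fun i j hij => by
      simp only [S]
      split_ifs <;> first | (exfalso; omega) | exact h | exact h.symm | simp)
  filter_upwards [h1, hzero] with ω hω hz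
  rw [hU] at hω
  refine tendsto_nhds_unique hω ?_
  rw [← tendsto_add_atTop_iff_nat 2]
  refine tendsto_const_nhds.congr fun N => ?_
  rw [Finset.sum_range_succ', Finset.sum_range_succ', Finset.sum_eq_zero]
  · simp [S, add_comm]
  · intro i _
    simpa [S] using hz

/-- A box of area `v` in the plane. -/
def unitHeightBox (x v : ℝ) : Set (ℝ × ℝ) := Set.Ioc x (x + v) ×ˢ Set.Ioc 0 1

theorem volume_unitHeightBox (x v : ℝ) : volume (unitHeightBox x v) = ENNReal.ofReal v := by
  simp [unitHeightBox, Measure.volume_eq_prod, Measure.prod_prod]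

theorem finiteBorel_unitHeightBox (x v : ℝ) : FiniteBorel volume (unitHeightBox x v) :=
  ⟨measurableSet_Ioc.prod measurableSet_Ioc, by simp [volume_unitHeightBox]⟩

theorem volume_real_unitHeightBox (x : ℝ) {v : ℝ} (hv : 0 ≤ v) :
    volume.real (unitHeightBox x v) = v := by
  simp [measureReal_def, volume_unitHeightBox, hv]

theorem unitHeightBox_union {x u v : ℝ} (hu : 0 ≤ u) (hv : 0 ≤ v) :
    unitHeightBox x u ∪ unitHeightBox (x + u) v = unitHeightBox x (u + v) := by
  rw [unitHeightBox, unitHeightBox, ← Set.union_prod, Set.Ioc_union_Ioc_eq_Ioc (by linarith)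
    (by linarith), unitHeightBox, add_assoc]

theorem disjoint_unitHeightBox (x u v : ℝ) :
    Disjoint (unitHeightBox x u) (unitHeightBox (x + u) v) := by
  rw [unitHeightBox, unitHeightBox, Set.disjoint_prod]
  left
  rw [Set.disjoint_left]
  rintro y ⟨_, h1⟩ ⟨h2, _⟩
  linarith

/-! ### Moments of a homogeneous Lévy basis -/

section Homogeneous

variable {Ω Ω' : Type*} [MeasurableSpace Ω] [MeasurableSpace Ω']
  {P : Measure Ω} [IsProbabilityMeasure P] {P' : Measure Ω'} [IsProbabilityMeasure P']
  {γ b : ℝ} {ν : Measure ℝ} {L : Set (ℝ × ℝ) → Ω → ℝ} {L' : Ω' → ℝ}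

/-- The characteristic function sees a set only through its area. This allows arbitrary sets to be
replaced by boxes. -/
theorem IsHomogeneousLevyBasis.identDistrib (hL : IsHomogeneousLevyBasis γ b ν P L)
    {A B : Set (ℝ × ℝ)} (hA : FiniteBorel volume A) (hB : FiniteBorel volume B)
    (h : volume.real A = volume.real B) : IdentDistrib (L A) (L B) P P := by
  have mA := hL.isLevyBasis.measurable A hA
  have mB := hL.isLevyBasis.measurable B hB
  refine ⟨mA.aemeasurable, mB.aemeasurable, ?_⟩
  have := Measure.isProbabilityMeasure_map (μ := P) mA.aemeasurable
  have := Measure.isProbabilityMeasure_map (μ := P) mB.aemeasurable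
  refine Measure.ext_of_charFun (funext fun z => ?_)
  rw [hL.charFun_eq A hA, hL.charFun_eq B hB, h]

theorem IsHomogeneousLevyBasis.identDistrib_seed (hL : IsHomogeneousLevyBasis γ b ν P L)
    (hL' : IsLevySeed γ b ν P' L') {A : Set (ℝ × ℝ)} (hA : FiniteBorel volume A)
    (h : volume.real A = 1) : IdentDistrib (L A) L' P P' := by
  have mA := hL.isLevyBasis.measurable A hA
  refine ⟨mA.aemeasurable, hL'.measurable.aemeasurable, ?_⟩
  have := Measure.isProbabilityMeasure_map (μ := P) mA.aemeasurable
  have := Measure.isProbabilityMeasure_map (μ := P') hL'.measurable.aemeasurable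
  refine Measure.ext_of_charFun (funext fun z => ?_)
  rw [hL.charFun_eq A hA, hL'.charFun_eq, h]
  simp

/-- A unit box has the law of the seed, and a box of integer area is a sum of unit boxes. A box of
area `v ≤ n` is an independent summand of the box of area `n`, hence inherits its fourth moment. -/
theorem IsHomogeneousLevyBasis.memLp (hL : IsHomogeneousLevyBasis γ b ν P L)
    (hL' : IsLevySeed γ b ν P' L') (hmoment : Integrable (fun ω => |L' ω| ^ 4) P')
    {A : Set (ℝ × ℝ)} (hA : FiniteBorel volume A) : MemLp (L A) 4 P := by
  have hseed : MemLp L' 4 P' := by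
    rw [← integrable_norm_rpow_iff hL'.measurable.aestronglyMeasurable (by norm_num) (by norm_num)]
    simpa using hmoment
  have hunit : ∀ x, MemLp (L (unitHeightBox x 1)) 4 P := fun x =>
    (hL.identDistrib_seed hL' (finiteBorel_unitHeightBox x 1)
      (volume_real_unitHeightBox x zero_le_one)).memLp_iff.2 hseed
  have hnat : ∀ n : ℕ, MemLp (L (unitHeightBox 0 n)) 4 P := fun n => by
    induction n with
    | zero =>
      have h := hL.isLevyBasis.union (.empty _) (.empty _) (disjoint_bot_left (a := ∅))
      have h0 : unitHeightBox 0 ((0 : ℕ) : ℝ) = ∅ := by simp [unitHeightBox]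
      rw [h0]
      refine (memLp_congr_ae ?_).2 (MemLp.zero' (p := 4) (μ := P) (ε := ℝ))
      filter_upwards [h] with ω hω
      simpa using hω
    | succ n ih =>
      have h := hL.isLevyBasis.union (finiteBorel_unitHeightBox 0 n)
        (finiteBorel_unitHeightBox (0 + n) 1) (disjoint_unitHeightBox 0 n 1)
      rw [unitHeightBox_union (Nat.cast_nonneg n) zero_le_one] at h
      rw [Nat.cast_succ]
      exact (memLp_congr_ae h).2 (ih.add (hunit _))
  set v := volume.real A with hv
  have hv0 : 0 ≤ v := measureReal_nonneg
  obtain ⟨n, hn⟩ := exists_nat_ge v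
  have h := hL.isLevyBasis.union (finiteBorel_unitHeightBox 0 v)
    (finiteBorel_unitHeightBox (0 + v) (n - v)) (disjoint_unitHeightBox 0 v _)
  rw [unitHeightBox_union hv0 (by linarith), add_sub_cancel] at h
  have hbox : MemLp (L (unitHeightBox 0 v)) 4 P :=
    MemLp.of_indepFun_add_left (hL.isLevyBasis.measurable _ (finiteBorel_unitHeightBox _ _))
      (hL.isLevyBasis.measurable _ (finiteBorel_unitHeightBox _ _))
      (hL.isLevyBasis.indep _ _ (finiteBorel_unitHeightBox _ _) (finiteBorel_unitHeightBox _ _)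
        (disjoint_unitHeightBox 0 v (n - v))) ((memLp_congr_ae h).1 (hnat n))
  exact (hL.identDistrib hA (finiteBorel_unitHeightBox 0 v)
    (by rw [volume_real_unitHeightBox _ hv0])).memLp_iff.2 hbox

/-- As a function of its area, the variance of a box is nonnegative and, adjacent boxes being
independent, additive. It is therefore linear, with slope the variance of the seed. -/
theorem IsHomogeneousLevyBasis.variance_eq (hL : IsHomogeneousLevyBasis γ b ν P L)
    (hL' : IsLevySeed γ b ν P' L') (hmoment : Integrable (fun ω => |L' ω| ^ 4) P')
    (hvar : variance L' P' = 1) {A : Set (ℝ × ℝ)} (hA : FiniteBorel volume A) :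
    variance (L A) P = volume.real A := by
  have h2 : ∀ {B}, FiniteBorel volume B → MemLp (L B) 2 P := fun hB =>
    (hL.memLp hL' hmoment hB).mono_exponent (by norm_num)
  rw [(hL.identDistrib hA (finiteBorel_unitHeightBox 0 _)
    (volume_real_unitHeightBox 0 measureReal_nonneg).symm).variance_eq]
  refine eq_mul_of_additive_of_nonneg (f := fun v => variance (L (unitHeightBox 0 v)) P)
    (fun v _ => variance_nonneg _ _) (fun u v hu hv => ?_) ?_ measureReal_nonneg
  · have h := hL.isLevyBasis.union (finiteBorel_unitHeightBox 0 u)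
      (finiteBorel_unitHeightBox (0 + u) v) (disjoint_unitHeightBox 0 u v)
    rw [unitHeightBox_union hu hv] at h
    rw [variance_congr h, IndepFun.variance_add (h2 (finiteBorel_unitHeightBox _ _))
      (h2 (finiteBorel_unitHeightBox _ _)) (hL.isLevyBasis.indep _ _
        (finiteBorel_unitHeightBox _ _) (finiteBorel_unitHeightBox _ _)
        (disjoint_unitHeightBox 0 u v))]
    congr 1
    exact (hL.identDistrib (finiteBorel_unitHeightBox _ _) (finiteBorel_unitHeightBox _ _)
      (by rw [volume_real_unitHeightBox _ hv, volume_real_unitHeightBox _ hv])).variance_eq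
  · exact (hL.identDistrib_seed hL' (finiteBorel_unitHeightBox 0 1)
      (volume_real_unitHeightBox 0 zero_le_one)).variance_eq.trans hvar

theorem IsHomogeneousLevyBasis.isCenteredNoise (hL : IsHomogeneousLevyBasis γ b ν P L)
    (hL' : IsLevySeed γ b ν P' L') (hmoment : Integrable (fun ω => |L' ω| ^ 4) P')
    (hvar : variance L' P' = 1) :
    IsCenteredNoise volume P (fun A ω => L A ω - ∫ ω', L A ω' ∂P) where
  memLp A hA := (hL.memLp hL' hmoment hA).sub (memLp_const _)
  union A B hA hB h := by
    have h1 := hL.isLevyBasis.union hA hB h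
    have iA := (hL.memLp hL' hmoment hA).integrable (by norm_num)
    have iB := (hL.memLp hL' hmoment hB).integrable (by norm_num)
    have h2 : ∫ ω', L (A ∪ B) ω' ∂P = ∫ ω', L A ω' ∂P + ∫ ω', L B ω' ∂P := by
      rw [integral_congr_ae h1, ← integral_add iA iB]; rfl
    filter_upwards [h1] with ω hω
    simp only [Pi.add_apply] at hω ⊢
    rw [hω, h2]; ring
  indep A B hA hB h := (hL.isLevyBasis.indep A B hA hB h).comp
    (measurable_id.sub_const (∫ ω', L A ω' ∂P)) (measurable_id.sub_const (∫ ω', L B ω' ∂P))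
  integral_eq_zero A hA := by
    rw [integral_sub ((hL.memLp hL' hmoment hA).integrable (by norm_num)) (integrable_const _)]
    simp
  integral_sq A hA := by
    rw [← hL.variance_eq hL' hmoment hvar hA,
      variance_eq_integral (hL.isLevyBasis.measurable A hA).aemeasurable]
  integral_pow_four A B hA hB h := by
    have h1 := hL.identDistrib hA hB h
    rw [h1.integral_eq]
    exact (h1.comp ((measurable_id.sub_const (∫ ω', L B ω' ∂P)).pow_const 4)).integral_eq

end Homogeneous

/-! ### Covariances and products of values of a centred noise -/

theorem integral_abs_mul_le_sqrt_mul_sqrt {Ω : Type*} [MeasurableSpace Ω] {P : Measure Ω}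
    {X Y : Ω → ℝ} (hX : MemLp X 2 P) (hY : MemLp Y 2 P) :
    ∫ ω, |X ω * Y ω| ∂P ≤ √(∫ ω, X ω ^ 2 ∂P) * √(∫ ω, Y ω ^ 2 ∂P) := by
  have h := integral_mul_norm_le_Lp_mul_Lq (μ := P) (f := X) (g := Y) (p := 2) (q := 2)
    Real.HolderConjugate.two_two (by simpa using hX) (by simpa using hY)
  simpa [abs_mul, Real.sqrt_eq_rpow] using h

theorem integrable_mul_of_memLp_two {Ω : Type*} [MeasurableSpace Ω] {P : Measure Ω}
    {X Y : Ω → ℝ} (hX : MemLp X 2 P) (hY : MemLp Y 2 P) :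
    Integrable (fun ω => X ω * Y ω) P := hX.integrable_mul hY

theorem memLp_two_mul_of_memLp_four {Ω : Type*} [MeasurableSpace Ω] {P : Measure Ω}
    {X Y : Ω → ℝ} (hX : MemLp X 4 P) (hY : MemLp Y 4 P) :
    MemLp (fun ω => X ω * Y ω) 2 P := by
  have : ENNReal.HolderTriple 4 4 2 := ⟨by
    rw [show (4 : ENNReal) = 2 * 2 by norm_num,
      ENNReal.mul_inv (by norm_num) (by norm_num), ← mul_add, ENNReal.inv_two_add_inv_two, mul_one]⟩
  exact hY.mul' hX

namespace IsCenteredNoise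

variable {E Ω : Type*} [MeasurableSpace E] [MeasurableSpace Ω] {m : Measure E}
  {P : Measure Ω} {M : Set E → Ω → ℝ} {A B C D : Set E}

theorem memLp_two_mul (hM : IsCenteredNoise m P M) (hA : FiniteBorel m A)
    (hB : FiniteBorel m B) : MemLp (fun ω => M A ω * M B ω) 2 P :=
  memLp_two_mul_of_memLp_four (hM.memLp A hA) (hM.memLp B hB)

theorem memLp_two_sq (hM : IsCenteredNoise m P M) (hA : FiniteBorel m A) :
    MemLp (fun ω => M A ω ^ 2) 2 P := by
  simpa only [pow_two] using hM.memLp_two_mul hA hA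

/-- The product of two values of the noise is a linear combination of squares. -/
theorem mul_ae_eq (hM : IsCenteredNoise m P M) (hA : FiniteBorel m A) (hB : FiniteBorel m B) :
    (fun ω => M A ω * M B ω) =ᵐ[P] fun ω => 2⁻¹ * M (A \ B ∪ B \ A) ω ^ 2 + 2⁻¹ * M A ω ^ 2
      + 2⁻¹ * M B ω ^ 2 - M (A \ B) ω ^ 2 - M (B \ A) ω ^ 2 := by
  have h1 := hM.union _ _ (hA.diff hB) (hA.inter hB) Set.disjoint_sdiff_inter
  have h2 := hM.union _ _ (hB.diff hA) (hB.inter hA) Set.disjoint_sdiff_inter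
  have h3 := hM.union _ _ (hA.diff hB) (hB.diff hA) disjoint_sdiff_sdiff
  rw [Set.sdiff_union_inter] at h1 h2
  rw [Set.inter_comm] at h2
  filter_upwards [h1, h2, h3] with ω h1 h2 h3
  simp only [Pi.add_apply] at h1 h2 h3
  rw [h1, h2, h3]; ring

theorem integral_mul_sq_le (hM : IsCenteredNoise m P M) (hA : FiniteBorel m A)
    (hB : FiniteBorel m B) :
    ∫ ω, (M A ω * M B ω) ^ 2 ∂P ≤ 2⁻¹ * (∫ ω, M A ω ^ 4 ∂P + ∫ ω, M B ω ^ 4 ∂P) := by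
  have i1 : Integrable (fun ω => M A ω ^ 4) P := by
    simpa only [← pow_mul] using (hM.memLp_two_sq hA).integrable_sq
  have i2 : Integrable (fun ω => M B ω ^ 4) P := by
    simpa only [← pow_mul] using (hM.memLp_two_sq hB).integrable_sq
  rw [← integral_add i1 i2, ← integral_const_mul]
  refine integral_mono (hM.memLp_two_mul hA hB).integrable_sq ((i1.add i2).const_mul _)
    fun ω => ?_
  simp only
  nlinarith [sq_nonneg (M A ω ^ 2 - M B ω ^ 2)]

variable [IsProbabilityMeasure P]

theorem memLp_two (hM : IsCenteredNoise m P M) (hA : FiniteBorel m A) : MemLp (M A) 2 P :=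
  (hM.memLp A hA).mono_exponent (by norm_num)

theorem integral_mul (hM : IsCenteredNoise m P M) (hA : FiniteBorel m A)
    (hB : FiniteBorel m B) : ∫ ω, M A ω * M B ω ∂P = m.real (A ∩ B) := by
  have i : ∀ {U}, FiniteBorel m U → Integrable (fun ω => M U ω ^ 2) P :=
    fun hU => (hM.memLp_two hU).integrable_sq
  have ha := hA.diff hB
  have hb := hB.diff hA
  have hab := ha.union hb
  have h1 := measureReal_union (μ := m) (s₁ := A \ B) (s₂ := B \ A) disjoint_sdiff_sdiff hb.1
    ha.2.ne hb.2.ne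
  have h2 := measureReal_sdiff_add_inter (μ := m) (s := A) (t := B) hB.1 hA.2.ne
  have h3 := measureReal_sdiff_add_inter (μ := m) (s := B) (t := A) hA.1 hB.2.ne
  rw [Set.inter_comm] at h3
  rw [integral_congr_ae (hM.mul_ae_eq hA hB), integral_sub, integral_sub, integral_add,
    integral_add, integral_const_mul, integral_const_mul, integral_const_mul,
    hM.integral_sq _ ha, hM.integral_sq _ hb, hM.integral_sq _ hab, hM.integral_sq _ hA,
    hM.integral_sq _ hB]
  · linarith
  · exact (i hab).const_mul _
  · exact (i hA).const_mul _
  · exact ((i hab).const_mul _).add ((i hA).const_mul _)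
  · exact (i hB).const_mul _
  · exact (((i hab).const_mul _).add ((i hA).const_mul _)).add ((i hB).const_mul _)
  · exact i ha
  · exact ((((i hab).const_mul _).add ((i hA).const_mul _)).add ((i hB).const_mul _)).sub (i ha)
  · exact i hb

/-- Polarisation through `mul_ae_eq`, on one side of the covariance. Applied to each side in turn,
it reduces products to squares of single values, for which pairwise independence is enough. -/
theorem covariance_mul_left_eq_zero (hM : IsCenteredNoise m P M) (hA : FiniteBorel m A)
    (hB : FiniteBorel m B) {g : Ω → ℝ} (hg : MemLp g 2 P)
    (h : ∀ U, FiniteBorel m U → U ⊆ A ∪ B → cov[fun ω => M U ω ^ 2, g; P] = 0) :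
    cov[fun ω => M A ω * M B ω, g; P] = 0 := by
  have i : ∀ {U}, FiniteBorel m U → MemLp (fun ω => M U ω ^ 2) 2 P := hM.memLp_two_sq
  have ha := hA.diff hB
  have hb := hB.diff hA
  have hab := ha.union hb
  have j1 := (i hab).const_mul 2⁻¹
  have j2 := (i hA).const_mul 2⁻¹
  have j3 := (i hB).const_mul 2⁻¹
  have sa : A \ B ⊆ A ∪ B := Set.sdiff_subset.trans Set.subset_union_left
  have sb : B \ A ⊆ A ∪ B := Set.sdiff_subset.trans Set.subset_union_right
  have heq : cov[fun ω => M A ω * M B ω, g; P]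
      = cov[((fun ω => 2⁻¹ * M (A \ B ∪ B \ A) ω ^ 2) + (fun ω => 2⁻¹ * M A ω ^ 2)
      + (fun ω => 2⁻¹ * M B ω ^ 2)) - (fun ω => M (A \ B) ω ^ 2) - (fun ω => M (B \ A) ω ^ 2),
        g; P] := by
    have h0 := hM.mul_ae_eq hA hB
    unfold covariance
    rw [integral_congr_ae h0]
    refine integral_congr_ae ?_
    filter_upwards [h0] with ω hω
    rw [hω]; rfl
  rw [heq, covariance_sub_left (((j1.add j2).add j3).sub (i ha)) (i hb) hg,
    covariance_sub_left ((j1.add j2).add j3) (i ha) hg,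
    covariance_add_left (j1.add j2) j3 hg, covariance_add_left j1 j2 hg,
    covariance_const_mul_left, covariance_const_mul_left, covariance_const_mul_left,
    h _ ha sa, h _ hb sb, h _ hab (Set.union_subset sa sb), h _ hA Set.subset_union_left,
    h _ hB Set.subset_union_right]
  simp

theorem covariance_mul_mul_eq_zero (hM : IsCenteredNoise m P M) (hA : FiniteBorel m A)
    (hB : FiniteBorel m B) (hC : FiniteBorel m C) (hD : FiniteBorel m D)
    (h : Disjoint (A ∪ B) (C ∪ D)) :
    cov[fun ω => M A ω * M B ω, fun ω => M C ω * M D ω; P] = 0 := by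
  refine hM.covariance_mul_left_eq_zero hA hB (hM.memLp_two_mul hC hD) fun U hU hUs => ?_
  rw [covariance_comm]
  refine hM.covariance_mul_left_eq_zero hC hD (hM.memLp_two_sq hU) fun V hV hVs => ?_
  rw [covariance_comm]
  exact IndepFun.covariance_eq_zero
    ((hM.indep U V hU hV (h.mono hUs hVs)).comp (measurable_id.pow_const 2)
      (measurable_id.pow_const 2)) (hM.memLp_two_sq hU) (hM.memLp_two_sq hV)

theorem integral_sub_sq (hM : IsCenteredNoise m P M) (hA : FiniteBorel m A)
    (hB : FiniteBorel m B) :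
    ∫ ω, (M A ω - M B ω) ^ 2 ∂P = m.real A + m.real B - 2 * m.real (A ∩ B) := by
  have i1 := (hM.memLp_two hA).integrable_sq
  have i2 := (hM.memLp_two hB).integrable_sq
  have i3 := (integrable_mul_of_memLp_two (hM.memLp_two hA) (hM.memLp_two hB)).const_mul 2
  have : ∀ ω, (M A ω - M B ω) ^ 2 = M A ω ^ 2 + M B ω ^ 2 - 2 * (M A ω * M B ω) :=
    fun ω => by ring
  simp_rw [this]
  have i4 : Integrable (fun ω => M A ω ^ 2 + M B ω ^ 2) P := i1.add i2
  rw [integral_sub i4 i3, integral_add i1 i2, integral_const_mul, hM.integral_sq _ hA,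
    hM.integral_sq _ hB, hM.integral_mul hA hB]

theorem integral_sub_sq_of_subset (hM : IsCenteredNoise m P M) (hA : FiniteBorel m A)
    (hB : FiniteBorel m B) (h : B ⊆ A) :
    ∫ ω, (M A ω - M B ω) ^ 2 ∂P = m.real (A \ B) := by
  rw [hM.integral_sub_sq hA hB, Set.inter_eq_self_of_subset_right h,
    measureReal_sdiff h hB.1 hA.2.ne]
  ring

/-- Cauchy–Schwarz applied to both terms of `xy - zw = x(y - w) + (x - z)w`. It controls the cost of
truncating both factors of a product. -/
theorem integral_abs_mul_sub_mul_le (hM : IsCenteredNoise m P M) (hA : FiniteBorel m A)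
    (hB : FiniteBorel m B) (hC : FiniteBorel m C) (hD : FiniteBorel m D) (hCA : C ⊆ A)
    (hDB : D ⊆ B) :
    ∫ ω, |M A ω * M B ω - M C ω * M D ω| ∂P
      ≤ √(m.real A) * √(m.real (B \ D)) + √(m.real (A \ C)) * √(m.real B) := by
  have a := hM.memLp_two hA
  have b := hM.memLp_two hB
  have c := hM.memLp_two hC
  have d := hM.memLp_two hD
  have h1 := integral_abs_mul_le_sqrt_mul_sqrt a (b.sub d)
  have h2 := integral_abs_mul_le_sqrt_mul_sqrt (a.sub c) d
  simp only [Pi.sub_apply] at h1 h2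
  rw [hM.integral_sq _ hA, hM.integral_sub_sq_of_subset hB hD hDB] at h1
  rw [hM.integral_sq _ hD, hM.integral_sub_sq_of_subset hA hC hCA] at h2
  have i1 : Integrable (fun ω => |M A ω * (M B ω - M D ω)|) P :=
    (integrable_mul_of_memLp_two a (b.sub d)).abs
  have i2 : Integrable (fun ω => |(M A ω - M C ω) * M D ω|) P :=
    (integrable_mul_of_memLp_two (a.sub c) d).abs
  have h3 : √(m.real D) ≤ √(m.real B) := Real.sqrt_le_sqrt (measureReal_mono hDB hB.2.ne)
  calc ∫ ω, |M A ω * M B ω - M C ω * M D ω| ∂P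
      ≤ ∫ ω, (|M A ω * (M B ω - M D ω)| + |(M A ω - M C ω) * M D ω|) ∂P := by
        refine integral_mono ((integrable_mul_of_memLp_two a b).sub
          (integrable_mul_of_memLp_two c d)).abs (i1.add i2) fun ω => ?_
        refine le_trans (le_of_eq ?_) (abs_add_le _ _)
        congr 1; ring
    _ ≤ _ := by
        rw [integral_add i1 i2]
        exact add_le_add h1 (h2.trans (by gcongr))

end IsCenteredNoise

/-! ### Convergence in probability to constants -/

section ConvergenceInMeasure

variable {Ω : Type*} [MeasurableSpace Ω] {P : Measure Ω}

theorem MeasureTheory.TendstoInMeasure.comp₂_continuousAt {f g : ℕ → Ω → ℝ} {x y : ℝ}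
    (hf : TendstoInMeasure P f atTop (fun _ => x)) (hg : TendstoInMeasure P g atTop (fun _ => y))
    {φ : ℝ → ℝ → ℝ} (hφ : ContinuousAt (fun p : ℝ × ℝ => φ p.1 p.2) (x, y)) :
    TendstoInMeasure P (fun n ω => φ (f n ω) (g n ω)) atTop (fun _ => φ x y) := by
  rw [tendstoInMeasure_iff_dist] at hf hg ⊢
  intro ε hε
  obtain ⟨δ, hδ, h⟩ := Metric.continuousAt_iff.1 hφ ε hε
  have hsum := (hf δ hδ).add (hg δ hδ)
  rw [add_zero] at hsum
  refine tendsto_of_tendsto_of_tendsto_of_le_of_le tendsto_const_nhds hsum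
    (fun _ => zero_le) fun n => ?_
  refine (measure_mono fun ω hω => ?_).trans (measure_union_le _ _)
  by_contra hcon
  simp only [Set.mem_union, Set.mem_ofPred_eq, not_or, not_le] at hcon
  have := @h (f n ω, g n ω) (by rw [Prod.dist_eq]; exact max_lt hcon.1 hcon.2)
  exact absurd hω (not_le.2 this)

theorem MeasureTheory.TendstoInMeasure.add_const_limits {f g : ℕ → Ω → ℝ} {x y : ℝ}
    (hf : TendstoInMeasure P f atTop (fun _ => x))
    (hg : TendstoInMeasure P g atTop (fun _ => y)) :
    TendstoInMeasure P (fun n ω => f n ω + g n ω) atTop (fun _ => x + y) :=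
  hf.comp₂_continuousAt hg (φ := fun a b => a + b) (by fun_prop)

theorem MeasureTheory.TendstoInMeasure.sub_const_limits {f g : ℕ → Ω → ℝ} {x y : ℝ}
    (hf : TendstoInMeasure P f atTop (fun _ => x))
    (hg : TendstoInMeasure P g atTop (fun _ => y)) :
    TendstoInMeasure P (fun n ω => f n ω - g n ω) atTop (fun _ => x - y) :=
  hf.comp₂_continuousAt hg (φ := fun a b => a - b) (by fun_prop)

theorem MeasureTheory.TendstoInMeasure.mul_const_limits {f g : ℕ → Ω → ℝ} {x y : ℝ}
    (hf : TendstoInMeasure P f atTop (fun _ => x))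
    (hg : TendstoInMeasure P g atTop (fun _ => y)) :
    TendstoInMeasure P (fun n ω => f n ω * g n ω) atTop (fun _ => x * y) :=
  hf.comp₂_continuousAt hg (φ := fun a b => a * b) (by fun_prop)

theorem MeasureTheory.TendstoInMeasure.of_tendsto_integral_abs {f : ℕ → Ω → ℝ}
    (hf : ∀ n, Integrable (f n) P) (h : Tendsto (fun n => ∫ ω, |f n ω| ∂P) atTop (𝓝 0)) :
    TendstoInMeasure P f atTop (fun _ => 0) := by
  refine tendstoInMeasure_of_tendsto_eLpNorm one_ne_zero (fun n => (hf n).1)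
    aestronglyMeasurable_const ?_
  have h1 := ENNReal.tendsto_ofReal h
  rw [ENNReal.ofReal_zero] at h1
  refine h1.congr fun n => ?_
  have h2 : f n - (fun _ => (0 : ℝ)) = f n := by ext; simp
  rw [h2, eLpNorm_one_eq_lintegral_enorm, ← ofReal_integral_norm_eq_lintegral_enorm (hf n)]
  rfl

theorem MeasureTheory.TendstoInMeasure.of_tendsto [IsFiniteMeasure P] {u : ℕ → ℝ} {x : ℝ}
    (h : Tendsto u atTop (𝓝 x)) :
    TendstoInMeasure P (fun n (_ : Ω) => u n) atTop (fun _ => x) :=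
  tendstoInMeasure_of_tendsto_ae (fun _ => aestronglyMeasurable_const) (ae_of_all _ fun _ => h)

end ConvergenceInMeasure

/-! ### A weak law under approximate finite-range dependence -/

section WeakLaw

variable {Ω : Type*} [MeasurableSpace Ω] {P : Measure Ω} [IsProbabilityMeasure P]

theorem integral_abs_le_sqrt {X : Ω → ℝ} (hX : MemLp X 2 P) :
    ∫ ω, |X ω| ∂P ≤ √(∫ ω, X ω ^ 2 ∂P) := by
  simpa using integral_abs_mul_le_sqrt_mul_sqrt hX (memLp_const (1 : ℝ))

theorem card_filter_near_le (c d j : ℕ) :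
    ((Finset.range c).filter (fun k => ¬ (j + d < k ∨ k + d < j))).card ≤ 2 * d + 1 := by
  have h : (Finset.range c).filter (fun k => ¬ (j + d < k ∨ k + d < j))
      ⊆ Finset.Icc (j - d) (j + d) := by
    intro k hk
    simp only [Finset.mem_filter, Finset.mem_Icc] at hk ⊢
    omega
  refine (Finset.card_le_card h).trans ?_
  rw [Nat.card_Icc]; omega

/-- An `L¹` bound for averages of finite-range dependent variables. -/
theorem integral_abs_average_le {W : ℕ → Ω → ℝ} {c n d : ℕ} {K : ℝ} (hc : c ≤ n)
    (hK0 : 0 ≤ K) (hW : ∀ k, MemLp (W k) 2 P) (hK : ∀ k, ∫ ω, W k ω ^ 2 ∂P ≤ K)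
    (h0 : ∀ j k, j + d < k → ∫ ω, W j ω * W k ω ∂P = 0) :
    ∫ ω, |(1 / (n : ℝ)) * ∑ k ∈ Finset.range c, W k ω| ∂P ≤ √((2 * d + 1) * K / n) := by
  have hS : MemLp (fun ω => ∑ k ∈ Finset.range c, W k ω) 2 P :=
    memLp_finsetSum _ fun k _ => hW k
  refine (integral_abs_le_sqrt (hS.const_mul _)).trans (Real.sqrt_le_sqrt ?_)
  have hi : ∀ j k, Integrable (fun ω => W j ω * W k ω) P :=
    fun j k => integrable_mul_of_memLp_two (hW j) (hW k)
  have hjk : ∀ j k, ∫ ω, W j ω * W k ω ∂P ≤ K := fun j k => by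
    calc ∫ ω, W j ω * W k ω ∂P ≤ ∫ ω, (2⁻¹ * W j ω ^ 2 + 2⁻¹ * W k ω ^ 2) ∂P := by
          refine integral_mono (hi j k)
            (((hW j).integrable_sq.const_mul _).add ((hW k).integrable_sq.const_mul _))
            fun ω => ?_
          simp only
          nlinarith [sq_nonneg (W j ω - W k ω)]
      _ ≤ K := by
          rw [integral_add ((hW j).integrable_sq.const_mul _) ((hW k).integrable_sq.const_mul _),
            integral_const_mul, integral_const_mul]
          linarith [hK j, hK k]
  -- In each of the `c` rows of the double sum at most `2d + 1` terms survive, each at most `K`.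
  have hsum : ∫ ω, (∑ k ∈ Finset.range c, W k ω) ^ 2 ∂P ≤ c * ((2 * d + 1) * K) := by
    simp_rw [pow_two, Finset.sum_mul_sum]
    rw [integral_finsetSum _ fun j _ => integrable_finsetSum _ fun k _ => hi j k]
    have hrow : ∀ j ∈ Finset.range c,
        ∫ ω, ∑ k ∈ Finset.range c, W j ω * W k ω ∂P ≤ (2 * d + 1) * K := fun j _ => by
      rw [integral_finsetSum _ fun k _ => hi j k,
        ← Finset.sum_filter_add_sum_filter_not _ (fun k => j + d < k ∨ k + d < j),
        Finset.sum_eq_zero, zero_add]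
      · refine (Finset.sum_le_card_nsmul _ _ K fun k _ => hjk j k).trans ?_
        rw [nsmul_eq_mul]
        gcongr
        exact_mod_cast card_filter_near_le c d j
      · intro k hk
        rcases (Finset.mem_filter.1 hk).2 with h | h
        · exact h0 j k h
        · simpa only [mul_comm] using h0 k j h
    refine (Finset.sum_le_card_nsmul _ _ _ hrow).trans ?_
    rw [Finset.card_range, nsmul_eq_mul]
  simp_rw [mul_pow]
  rw [integral_const_mul]
  rcases Nat.eq_zero_or_pos n with rfl | hn
  · simp
  have hn' : (0 : ℝ) < n := by exact_mod_cast hn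
  have hcn : (c : ℝ) ≤ n := by exact_mod_cast hc
  calc (1 / (n : ℝ)) ^ 2 * ∫ ω, (∑ k ∈ Finset.range c, W k ω) ^ 2 ∂P
      ≤ (1 / (n : ℝ)) ^ 2 * (n * ((2 * d + 1) * K)) := by
        gcongr
        exact hsum.trans (by gcongr)
    _ = (2 * d + 1) * K / n := by field_simp

/-- A time range `D` spans about `D / Δ n` indices, and its ratio to `n` is `D / (n * Δ n)`. This is
where the growing observation window makes the variance vanish. -/
theorem tendsto_sqrt_dependence_range_div {Δ : ℕ → ℝ} (hΔpos : ∀ n, 0 < Δ n) {D : ℝ} (hD : 0 ≤ D)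
    (K : ℝ) (hnΔ : Tendsto (fun n : ℕ => (n : ℝ) * Δ n) atTop atTop) :
    Tendsto (fun n : ℕ => √((2 * ⌈D / Δ n⌉₊ + 1) * K / n)) atTop (𝓝 0) := by
  have h1 : Tendsto (fun n : ℕ => 2 * (D / ((n : ℝ) * Δ n)) + 3 / (n : ℝ)) atTop (𝓝 0) := by
    have e1 := (hnΔ.const_div_atTop D).const_mul 2
    have e2 := tendsto_natCast_atTop_atTop (R := ℝ).const_div_atTop 3
    simpa using e1.add e2
  have h2 : Tendsto (fun n : ℕ => (2 * (⌈D / Δ n⌉₊ : ℝ) + 1) / n) atTop (𝓝 0) := by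
    refine tendsto_of_tendsto_of_tendsto_of_le_of_le tendsto_const_nhds h1
      (fun n => by positivity) fun n => ?_
    rcases Nat.eq_zero_or_pos n with rfl | hn
    · simp
    have hn' : (0 : ℝ) < n := by exact_mod_cast hn
    have e := (Nat.ceil_lt_add_one (div_nonneg hD (hΔpos n).le)).le
    have : 2 * (D / ((n : ℝ) * Δ n)) + 3 / (n : ℝ) = (2 * (D / Δ n + 1) + 1) / n := by
      have := (hΔpos n).ne'
      field_simp
      ring
    simp only
    rw [this]
    gcongr
  have h3 := (h2.mul_const K).sqrt
  rw [zero_mul, Real.sqrt_zero] at h3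
  refine h3.congr fun n => ?_
  rw [div_mul_eq_mul_div]

/-- A weak law of large numbers for triangular arrays which can be approximated by arrays of
finite-range dependence. -/
theorem tendstoInMeasure_average {Z : ℕ → ℕ → Ω → ℝ} {Δ : ℕ → ℝ} {c : ℕ → ℕ}
    (hΔpos : ∀ n, 0 < Δ n) (hnΔ : Tendsto (fun n : ℕ => (n : ℝ) * Δ n) atTop atTop)
    (hc : ∀ n, c n ≤ n) (hZ : ∀ n k, Integrable (Z n k) P)
    (h : ∀ ε > 0, ∃ D K : ℝ, 0 ≤ D ∧ 0 ≤ K ∧ ∀ᶠ n in atTop, ∃ W : ℕ → Ω → ℝ,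
      (∀ k, MemLp (W k) 2 P) ∧ (∀ k, ∫ ω, W k ω ^ 2 ∂P ≤ K) ∧
      (∀ j k : ℕ, j * Δ n + D < k * Δ n → ∫ ω, W j ω * W k ω ∂P = 0) ∧
      ∀ k, ∫ ω, |Z n k ω - W k ω| ∂P ≤ ε) :
    TendstoInMeasure P (fun (n : ℕ) ω => (1 / (n : ℝ)) * ∑ k ∈ Finset.range (c n), Z n k ω) atTop
      (fun _ => 0) := by
  have hZs : ∀ n : ℕ, Integrable (fun ω => (1 / (n : ℝ)) * ∑ k ∈ Finset.range (c n), Z n k ω) P :=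
    fun n => (integrable_finsetSum _ fun k _ => hZ n k).const_mul _
  refine TendstoInMeasure.of_tendsto_integral_abs hZs ?_
  rw [Metric.tendsto_atTop']
  intro ε hε
  obtain ⟨D, K, hD, hK, hW⟩ := h (ε / 2) (half_pos hε)
  -- Half of `ε` pays for the approximation, the other half for the average of the approximants; `D`
  -- and `K` are fixed before `n` grows.
  have h1 := (tendsto_sqrt_dependence_range_div hΔpos hD K hnΔ).eventually_lt_const (half_pos hε)
  obtain ⟨N, hN⟩ := eventually_atTop.1 (hW.and (h1.and (eventually_gt_atTop 0)))
  refine ⟨N, fun n hn => ?_⟩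
  obtain ⟨⟨W, hW2, hWK, hW0, hWZ⟩, hsmall, hn0⟩ := hN n hn.le
  have hn' : (0 : ℝ) < n := by exact_mod_cast hn0
  rw [Real.dist_eq, sub_zero, abs_of_nonneg (integral_nonneg fun _ => abs_nonneg _)]
  have hWi : ∀ k, Integrable (W k) P := fun k => (hW2 k).integrable (by norm_num)
  have hWs : Integrable (fun ω => (1 / (n : ℝ)) * ∑ k ∈ Finset.range (c n), W k ω) P :=
    (integrable_finsetSum _ fun k _ => hWi k).const_mul _
  have hdi : ∀ k, Integrable (fun ω => |Z n k ω - W k ω|) P :=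
    fun k => ((hZ n k).sub (hWi k)).abs
  have hds : Integrable
      (fun ω => (1 / (n : ℝ)) * ∑ k ∈ Finset.range (c n), |Z n k ω - W k ω|) P :=
    (integrable_finsetSum _ fun k _ => hdi k).const_mul _
  have hmain := integral_abs_average_le (d := ⌈D / Δ n⌉₊) (hc n) hK hW2 hWK fun j k hjk => by
    refine hW0 j k ?_
    have e1 : (j : ℝ) + ⌈D / Δ n⌉₊ < k := by exact_mod_cast hjk
    have e2 : D ≤ ⌈D / Δ n⌉₊ * Δ n := (div_le_iff₀ (hΔpos n)).1 (Nat.le_ceil _)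
    have e3 := mul_lt_mul_of_pos_right e1 (hΔpos n)
    rw [add_mul] at e3
    linarith
  have hdiff : ∫ ω, (1 / (n : ℝ)) * ∑ k ∈ Finset.range (c n), |Z n k ω - W k ω| ∂P ≤ ε / 2 := by
    rw [integral_const_mul, integral_finsetSum _ fun k _ => hdi k]
    have e1 := Finset.sum_le_card_nsmul (Finset.range (c n)) _ _ fun k _ => hWZ k
    rw [Finset.card_range, nsmul_eq_mul] at e1
    have hcn : (c n : ℝ) ≤ n := by exact_mod_cast hc n
    calc _ ≤ (1 / (n : ℝ)) * (n * (ε / 2)) := by gcongr; exact e1.trans (by gcongr)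
      _ = ε / 2 := by field_simp
  calc ∫ ω, |(1 / (n : ℝ)) * ∑ k ∈ Finset.range (c n), Z n k ω| ∂P
      ≤ ∫ ω, ((1 / (n : ℝ)) * ∑ k ∈ Finset.range (c n), |Z n k ω - W k ω|
        + |(1 / (n : ℝ)) * ∑ k ∈ Finset.range (c n), W k ω|) ∂P := by
        refine integral_mono (hZs n).abs (hds.add hWs.abs) fun ω => ?_
        have e : (1 / (n : ℝ)) * ∑ k ∈ Finset.range (c n), Z n k ω
            = (1 / (n : ℝ)) * ∑ k ∈ Finset.range (c n), (Z n k ω - W k ω)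
              + (1 / (n : ℝ)) * ∑ k ∈ Finset.range (c n), W k ω := by
          rw [Finset.sum_sub_distrib]; ring
        simp only
        rw [e]
        refine (abs_add_le _ _).trans (add_le_add_left ?_ _)
        rw [abs_mul, abs_of_nonneg (by positivity : 0 ≤ 1 / (n : ℝ))]
        gcongr
        exact Finset.abs_sum_le_sum_abs _ _
    _ < ε := by
        rw [integral_add hds hWs.abs]
        linarith

end WeakLaw

/-! ### Geometry of trawl sets -/

theorem mem_trawlSetAt {a : ℝ → ℝ} {t : ℝ} {p : ℝ × ℝ} :
    p ∈ trawlSetAt a t ↔ p.1 ≤ t ∧ 0 ≤ p.2 ∧ p.2 ≤ a (t - p.1) := by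
  simp only [trawlSetAt, trawlSet, Set.mem_image, Set.mem_ofPred_eq]
  constructor
  · rintro ⟨q, ⟨h1, h2, h3⟩, rfl⟩
    refine ⟨by simpa using h1, by simpa using h2, ?_⟩
    have : t - (q + (t, 0)).1 = -q.1 := by simp
    rw [this]; simpa using h3
  · rintro ⟨h1, h2, h3⟩
    refine ⟨p - (t, 0), ⟨by simpa using h1, by simpa using h2, ?_⟩, by simp⟩
    have : -(p - (t, 0)).1 = t - p.1 := by simp
    rw [this]; simpa using h3

theorem trawlSetAt_zero (a : ℝ → ℝ) : trawlSetAt a 0 = trawlSet a := by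
  ext p
  rw [mem_trawlSetAt]
  simp [trawlSet]

theorem IsTrawlFunction.measurableSet_trawlSetAt {a : ℝ → ℝ} (ha : IsTrawlFunction a) (t : ℝ) :
    MeasurableSet (trawlSetAt a t) := by
  -- Continuity is known only on the half-line, so `a` is replaced by its extension that is constant
  -- on the negative reals.
  have hc : Continuous (fun s => a (max s 0)) :=
    ha.continuousOn.comp_continuous (by fun_prop) fun s => Set.mem_Ici.2 (le_max_right _ _)
  have h : trawlSetAt a t = {p | p.1 ≤ t} ∩ {p | 0 ≤ p.2} ∩ {p | p.2 ≤ a (max (t - p.1) 0)} := by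
    ext p
    rw [mem_trawlSetAt]
    simp only [Set.mem_inter_iff, Set.mem_ofPred_eq, and_assoc]
    refine and_congr_right fun h => ?_
    rw [max_eq_left (by linarith)]
  rw [h]
  exact (((isClosed_le continuous_fst continuous_const).inter
    (isClosed_le continuous_const continuous_snd)).inter
    (isClosed_le continuous_snd (hc.comp (by fun_prop)))).measurableSet

theorem IsTrawlFunction.volume_trawlSet_lt_top {a : ℝ → ℝ} (ha : IsTrawlFunction a) :
    volume (trawlSet a) < ⊤ := by
  have hm := ha.measurableSet_trawlSetAt 0
  rw [trawlSetAt_zero] at hm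
  have hint : IntegrableOn (fun x => a (-x)) (Set.Iic 0) volume := by
    have h := ha.integrableOn
    rw [← neg_zero, ← (Measure.measurePreserving_neg (volume : Measure ℝ)).integrableOn_comp_preimage
      (Homeomorph.neg ℝ).measurableEmbedding] at h
    simpa [Function.comp_def] using h
  rw [Measure.volume_eq_prod, Measure.prod_apply hm]
  have hsec : ∀ x, volume (Prod.mk x ⁻¹' trawlSet a)
      = (Set.Iic 0).indicator (fun x => ENNReal.ofReal (a (-x))) x := fun x => by
    by_cases hx : x ≤ 0
    · have : Prod.mk x ⁻¹' trawlSet a = Set.Icc 0 (a (-x)) := by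
        ext y; simp [trawlSet, hx]
      rw [this, Set.indicator_of_mem (Set.mem_Iic.2 hx)]; simp
    · have : Prod.mk x ⁻¹' trawlSet a = ∅ := by
        ext y; simp [trawlSet, hx]
      rw [this, Set.indicator_of_notMem (by simpa using hx)]; simp
  simp_rw [hsec]
  rw [lintegral_indicator measurableSet_Iic]
  refine lt_of_le_of_lt (lintegral_mono fun x => ?_) hint.2
  exact Real.ofReal_le_enorm _

/-- The part of the trawl set at distance at least `u` from the vertical axis. -/
def trawlTail (a : ℝ → ℝ) (u : ℝ) : Set (ℝ × ℝ) := trawlSet a ∩ {p | p.1 ≤ -u}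

/-- The part of the trawl set at time `t` which reaches back at most `T` units of time. -/
def truncatedTrawlSetAt (a : ℝ → ℝ) (T t : ℝ) : Set (ℝ × ℝ) :=
  trawlSetAt a t ∩ {p | t - T < p.1}

theorem volume_trawlSetAt_inter (a : ℝ → ℝ) (t u : ℝ) :
    volume (trawlSetAt a t ∩ {p | p.1 ≤ t - u}) = volume (trawlTail a u) := by
  rw [← measure_preimage_add_right volume ((t, 0) : ℝ × ℝ)]
  congr 1
  ext p
  simp only [Set.mem_preimage, Set.mem_inter_iff, mem_trawlSetAt, trawlTail, trawlSet,
    Set.mem_ofPred_eq, Prod.fst_add, Prod.snd_add, add_zero]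
  have : t - (p.1 + t) = -p.1 := by ring
  rw [this]
  refine and_congr (and_congr ?_ Iff.rfl) ?_ <;> constructor <;> intro h <;> linarith

theorem trawlSetAt_inter_fst_le_sub_zero (a : ℝ → ℝ) (t : ℝ) :
    trawlSetAt a t ∩ {p | p.1 ≤ t - 0} = trawlSetAt a t := by
  rw [Set.inter_eq_left]
  intro p hp
  simpa using (mem_trawlSetAt.1 hp).1

theorem trawlTail_zero (a : ℝ → ℝ) : trawlTail a 0 = trawlSet a := by
  rw [trawlTail, Set.inter_eq_left]
  intro p hp
  simpa using hp.1

theorem volume_trawlSetAt (a : ℝ → ℝ) (t : ℝ) :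
    volume (trawlSetAt a t) = volume (trawlSet a) := by
  rw [← trawlSetAt_inter_fst_le_sub_zero, volume_trawlSetAt_inter, trawlTail_zero]

theorem measurableSet_fst_le (c : ℝ) : MeasurableSet {p : ℝ × ℝ | p.1 ≤ c} :=
  measurableSet_le measurable_fst measurable_const

theorem measurableSet_lt_fst (c : ℝ) : MeasurableSet {p : ℝ × ℝ | c < p.1} :=
  measurableSet_lt measurable_const measurable_fst

theorem disjoint_truncatedTrawlSetAt (a : ℝ → ℝ) {T s t : ℝ} (h : s + T ≤ t) :
    Disjoint (trawlSetAt a s) (truncatedTrawlSetAt a T t) := by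
  rw [Set.disjoint_left]
  rintro p hp ⟨_, hp2⟩
  have := (mem_trawlSetAt.1 hp).1
  simp only [Set.mem_ofPred_eq] at hp2
  linarith

theorem truncatedTrawlSetAt_subset (a : ℝ → ℝ) (T t : ℝ) :
    truncatedTrawlSetAt a T t ⊆ trawlSetAt a t := Set.inter_subset_left

theorem volume_real_sdiff_truncated (a : ℝ → ℝ) (T t : ℝ) :
    volume.real (trawlSetAt a t \ truncatedTrawlSetAt a T t) = volume.real (trawlTail a T) := by
  rw [measureReal_def, measureReal_def, ← volume_trawlSetAt_inter a t]
  congr 2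
  ext p
  simp [truncatedTrawlSetAt]

namespace IsTrawlFunction

variable {a : ℝ → ℝ}

theorem finiteBorel_trawlSetAt (ha : IsTrawlFunction a) (t : ℝ) :
    FiniteBorel volume (trawlSetAt a t) :=
  ⟨ha.measurableSet_trawlSetAt t, by rw [volume_trawlSetAt]; exact ha.volume_trawlSet_lt_top⟩

theorem finiteBorel_truncatedTrawlSetAt (ha : IsTrawlFunction a) (T t : ℝ) :
    FiniteBorel volume (truncatedTrawlSetAt a T t) :=
  (ha.finiteBorel_trawlSetAt t).mono
    ((ha.measurableSet_trawlSetAt t).inter (measurableSet_lt_fst _))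
    (truncatedTrawlSetAt_subset a T t)

theorem finiteBorel_trawlTail (ha : IsTrawlFunction a) (u : ℝ) :
    FiniteBorel volume (trawlTail a u) := by
  have h := ha.finiteBorel_trawlSetAt 0
  rw [trawlSetAt_zero] at h
  exact h.mono (h.1.inter (measurableSet_fst_le _)) Set.inter_subset_left

theorem volume_real_truncated (ha : IsTrawlFunction a) (T t : ℝ) :
    volume.real (truncatedTrawlSetAt a T t)
      = volume.real (trawlSet a) - volume.real (trawlTail a T) := by
  rw [← volume_real_sdiff_truncated a T t,
    measureReal_sdiff (truncatedTrawlSetAt_subset a T t)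
      (ha.finiteBorel_truncatedTrawlSetAt T t).1 (ha.finiteBorel_trawlSetAt t).2.ne,
    measureReal_def (s := trawlSetAt a t), volume_trawlSetAt, ← measureReal_def]
  ring

/-- Since `a` is non-increasing, a point of `A_t` to the left of `s` is already in `A_s`. The
overlap is thus the part of `A_t` at depth at least `t - s`. -/
theorem volume_real_inter (ha : IsTrawlFunction a) {s t : ℝ} (hst : s ≤ t) :
    volume.real (trawlSetAt a s ∩ trawlSetAt a t) = volume.real (trawlTail a (t - s)) := by
  rw [measureReal_def, measureReal_def, ← volume_trawlSetAt_inter a t]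
  congr 2
  ext p
  simp only [Set.mem_inter_iff, mem_trawlSetAt, Set.mem_ofPred_eq, sub_sub_cancel]
  constructor
  · rintro ⟨⟨h1, -, -⟩, h2⟩
    exact ⟨h2, h1⟩
  · rintro ⟨⟨h1, h2, h3⟩, h4⟩
    exact ⟨⟨h4, h2, h3.trans (ha.antitoneOn (Set.mem_Ici.2 (by linarith))
      (Set.mem_Ici.2 (by linarith)) (by linarith))⟩, h1, h2, h3⟩

/-- The difference of two tails fits in a strip of width `v - u` and height `a 0`; the resulting
Lipschitz bound gives continuity of the overlap in the lag. -/
theorem volume_real_trawlTail_sub (ha : IsTrawlFunction a) {u v : ℝ} (hu : 0 ≤ u)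
    (huv : u ≤ v) :
    0 ≤ volume.real (trawlTail a u) - volume.real (trawlTail a v) ∧
    volume.real (trawlTail a u) - volume.real (trawlTail a v) ≤ a 0 * (v - u) := by
  have hsub : trawlTail a v ⊆ trawlTail a u := fun p hp => ⟨hp.1, by
    have := hp.2
    simp only [Set.mem_ofPred_eq] at this ⊢
    linarith⟩
  rw [← measureReal_sdiff hsub (ha.finiteBorel_trawlTail v).1 (ha.finiteBorel_trawlTail u).2.ne]
  refine ⟨measureReal_nonneg, ?_⟩
  have hbox : trawlTail a u \ trawlTail a v ⊆ Set.Ioc (-v) (-u) ×ˢ Set.Icc 0 (a 0) := by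
    rintro p ⟨⟨⟨h1, h2, h3⟩, h4⟩, h5⟩
    simp only [Set.mem_ofPred_eq] at h4
    refine ⟨⟨?_, h4⟩, h2, h3.trans (ha.antitoneOn (Set.mem_Ici.2 le_rfl)
      (Set.mem_Ici.2 (by linarith)) (by linarith))⟩
    by_contra hcon
    exact h5 ⟨⟨h1, h2, h3⟩, not_lt.1 hcon⟩
  have hvol : volume (Set.Ioc (-v) (-u) ×ˢ Set.Icc 0 (a 0))
      = ENNReal.ofReal (v - u) * ENNReal.ofReal (a 0) := by
    rw [Measure.volume_eq_prod, Measure.prod_prod, Real.volume_Ioc, Real.volume_Icc, sub_zero]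
    congr 2; ring
  refine (measureReal_mono hbox (by rw [hvol]; finiteness)).trans (le_of_eq ?_)
  rw [measureReal_def, hvol, ENNReal.toReal_mul, ENNReal.toReal_ofReal (by linarith),
    ENNReal.toReal_ofReal (ha.nonneg 0 le_rfl), mul_comm]

theorem tendsto_volume_real_trawlTail (ha : IsTrawlFunction a) {u : ℕ → ℝ} {v : ℝ}
    (hu : ∀ n, v ≤ u n) (hv : 0 ≤ v) (h : Tendsto u atTop (𝓝 v)) :
    Tendsto (fun n => volume.real (trawlTail a (u n))) atTop (𝓝 (volume.real (trawlTail a v))) := by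
  have h1 : Tendsto (fun n => volume.real (trawlTail a v) - a 0 * (u n - v)) atTop
      (𝓝 (volume.real (trawlTail a v))) := by
    simpa using tendsto_const_nhds.sub ((h.sub_const v).const_mul (a 0))
  refine tendsto_of_tendsto_of_tendsto_of_le_of_le h1 tendsto_const_nhds (fun n => ?_) fun n => ?_
  · linarith [(ha.volume_real_trawlTail_sub hv (hu n)).2]
  · linarith [(ha.volume_real_trawlTail_sub hv (hu n)).1]

theorem exists_volume_real_trawlTail_lt (ha : IsTrawlFunction a) {ε : ℝ} (hε : 0 < ε) :
    ∃ T : ℝ, 0 ≤ T ∧ volume.real (trawlTail a T) < ε := by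
  have h := tendsto_measure_iInter_atTop (μ := (volume : Measure (ℝ × ℝ)))
    (s := fun n : ℕ => trawlTail a n)
    (fun n => (ha.finiteBorel_trawlTail n).1.nullMeasurableSet)
    (fun i j hij p hp => ⟨hp.1, by
      have h1 := hp.2
      have h2 : (i : ℝ) ≤ j := by exact_mod_cast hij
      simp only [Set.mem_ofPred_eq] at h1 ⊢
      linarith⟩) ⟨0, (ha.finiteBorel_trawlTail _).2.ne⟩
  have hempty : ⋂ n : ℕ, trawlTail a n = ∅ := by
    rw [Set.eq_empty_iff_forall_notMem]
    intro p hp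
    obtain ⟨n, hn⟩ := exists_nat_gt (-p.1)
    have := (Set.mem_iInter.1 hp n).2
    simp only [Set.mem_ofPred_eq] at this
    linarith
  rw [hempty, measure_empty] at h
  have h2 := (ENNReal.tendsto_toReal ENNReal.zero_ne_top).comp h
  obtain ⟨n, hn⟩ := (h2.eventually_lt_const (by simpa using hε)).exists
  exact ⟨n, Nat.cast_nonneg n, hn⟩

end IsTrawlFunction

/-! ### Consistency of the sample autocovariance -/

/-- The shift `μ` cancels. The terms are sorted by their limits: an average centred by `g`, a
deterministic term that carries the limit, and products of sample means that vanish. The number `g`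
is free, to be taken as the covariance at lag `l * Δ`. -/
theorem sampleAutocov_add_const (y : ℝ → ℝ) (μ g Δ : ℝ) (n l : ℕ) :
    sampleAutocov (fun t => y t + μ) Δ n l
      = (1 / (n : ℝ)) * ∑ k ∈ Finset.range (n - l), (y (k * Δ + l * Δ) * y (k * Δ) - g)
        + g * (((n - l : ℕ) : ℝ) / n)
        - ((1 / (n : ℝ)) * ∑ k ∈ Finset.range n, y (k * Δ))
          * ((1 / (n : ℝ)) * ∑ k ∈ Finset.range (n - l), y (k * Δ + l * Δ)
            + (1 / (n : ℝ)) * ∑ k ∈ Finset.range (n - l), y (k * Δ))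
        + (((n - l : ℕ) : ℝ) / n) * (((1 / (n : ℝ)) * ∑ k ∈ Finset.range n, y (k * Δ))
          * ((1 / (n : ℝ)) * ∑ k ∈ Finset.range n, y (k * Δ))) := by
  rcases Nat.eq_zero_or_pos n with rfl | hn
  · simp [sampleAutocov]
  have hn' : (n : ℝ) ≠ 0 := by exact_mod_cast hn.ne'
  have hmean : sampleMean (fun t => y t + μ) Δ n
      = (1 / (n : ℝ)) * ∑ k ∈ Finset.range n, y (k * Δ) + μ := by
    rw [sampleMean, Finset.sum_add_distrib, Finset.sum_const, Finset.card_range, nsmul_eq_mul,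
      mul_add, ← mul_assoc (1 / (n : ℝ)) n μ, one_div_mul_cancel hn', one_mul]
  rw [sampleAutocov, hmean]
  set m := (1 / (n : ℝ)) * ∑ k ∈ Finset.range n, y (k * Δ)
  have hterm : ∀ k : ℕ, (y (((l + k : ℕ) : ℝ) * Δ) + μ - (m + μ)) * (y (k * Δ) + μ - (m + μ))
      = (y (k * Δ + l * Δ) * y (k * Δ) - g) + g - m * y (k * Δ + l * Δ) - m * y (k * Δ)
        + m * m := fun k => by
    have : ((l + k : ℕ) : ℝ) * Δ = k * Δ + l * Δ := by push_cast; ring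
    rw [this]; ring
  simp_rw [hterm]
  rw [Finset.sum_add_distrib, Finset.sum_sub_distrib, Finset.sum_sub_distrib,
    Finset.sum_add_distrib, ← Finset.mul_sum, ← Finset.mul_sum, Finset.sum_const,
    Finset.sum_const, Finset.card_range, nsmul_eq_mul, nsmul_eq_mul]
  ring

theorem tendsto_sub_div_of_mul_tendsto {Δ : ℕ → ℝ} (hΔpos : ∀ n, 0 < Δ n)
    (hnΔ : Tendsto (fun n : ℕ => (n : ℝ) * Δ n) atTop atTop) {l : ℕ → ℕ} {h : ℝ}
    (hl : Tendsto (fun n => (l n : ℝ) * Δ n) atTop (𝓝 h)) :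
    Tendsto (fun n : ℕ => ((n - l n : ℕ) : ℝ) / n) atTop (𝓝 1) := by
  have h1 : Tendsto (fun n : ℕ => 1 - ((l n : ℝ) * Δ n) / ((n : ℝ) * Δ n)) atTop (𝓝 1) := by
    simpa using tendsto_const_nhds.sub (hl.div_atTop hnΔ)
  refine tendsto_of_tendsto_of_tendsto_of_le_of_le' h1 tendsto_const_nhds ?_ ?_
  · filter_upwards [eventually_gt_atTop 0] with n hn
    have hn' : (0 : ℝ) < n := by exact_mod_cast hn
    rw [mul_div_mul_right _ _ (hΔpos n).ne', one_sub_div hn'.ne']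
    gcongr
    rw [sub_le_iff_le_add]
    exact_mod_cast (by omega : n ≤ n - l n + l n)
  · filter_upwards [eventually_gt_atTop 0] with n hn
    have hn' : (0 : ℝ) < n := by exact_mod_cast hn
    rw [div_le_one hn']
    exact_mod_cast Nat.sub_le _ _

theorem IsTrawlFunction.exists_sqrt_volume_real_trawlTail_le {a : ℝ → ℝ} (ha : IsTrawlFunction a)
    {δ : ℝ} (hδ : 0 < δ) : ∃ T : ℝ, 0 ≤ T ∧ √(volume.real (trawlTail a T)) ≤ δ := by
  obtain ⟨T, hT, h⟩ := ha.exists_volume_real_trawlTail_lt (pow_pos hδ 2)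
  exact ⟨T, hT, Real.sqrt_le_iff.2 ⟨hδ.le, h.le⟩⟩

namespace IsCenteredNoise

variable {Ω : Type*} [MeasurableSpace Ω] {P : Measure Ω} [IsProbabilityMeasure P]
  {M : Set (ℝ × ℝ) → Ω → ℝ} {a : ℝ → ℝ} {Δ : ℕ → ℝ}

/-- The approximants are the noise on trawl sets cut at depth `T`: they are uncorrelated at time
lags beyond `T`, and the error in `L²` is the square root of the area of the tail. -/
theorem tendstoInMeasure_average_trawl (hM : IsCenteredNoise volume P M) (ha : IsTrawlFunction a)
    (hΔpos : ∀ n, 0 < Δ n) (hnΔ : Tendsto (fun n : ℕ => (n : ℝ) * Δ n) atTop atTop)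
    {c : ℕ → ℕ} (hc : ∀ n, c n ≤ n) (s : ℕ → ℝ) :
    TendstoInMeasure P (fun (n : ℕ) ω => (1 / (n : ℝ)) * ∑ k ∈ Finset.range (c n),
      M (trawlSetAt a (k * Δ n + s n)) ω) atTop (fun _ => 0) := by
  refine tendstoInMeasure_average hΔpos hnΔ hc
    (fun n k => (hM.memLp_two (ha.finiteBorel_trawlSetAt _)).integrable (by norm_num))
    fun ε hε => ?_
  obtain ⟨T, hT, hTε⟩ := ha.exists_sqrt_volume_real_trawlTail_le hε
  refine ⟨T, volume.real (trawlSet a), hT, measureReal_nonneg, .of_forall fun n =>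
    ⟨fun k => M (truncatedTrawlSetAt a T (k * Δ n + s n)), fun k =>
      hM.memLp_two (ha.finiteBorel_truncatedTrawlSetAt _ _), fun k => ?_, fun j k hjk => ?_,
      fun k => ?_⟩⟩
  · rw [hM.integral_sq _ (ha.finiteBorel_truncatedTrawlSetAt _ _), ha.volume_real_truncated]
    linarith [measureReal_nonneg (μ := volume) (s := trawlTail a T)]
  · rw [hM.integral_mul (ha.finiteBorel_truncatedTrawlSetAt _ _)
      (ha.finiteBorel_truncatedTrawlSetAt _ _), Set.disjoint_iff_inter_eq_empty.1
      ((disjoint_truncatedTrawlSetAt a (by linarith)).mono_left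
        (truncatedTrawlSetAt_subset a T _)), measureReal_empty]
  · refine (integral_abs_le_sqrt ((hM.memLp_two (ha.finiteBorel_trawlSetAt _)).sub
      (hM.memLp_two (ha.finiteBorel_truncatedTrawlSetAt T _)))).trans ?_
    simp only [Pi.sub_apply]
    rw [hM.integral_sub_sq_of_subset (ha.finiteBorel_trawlSetAt _)
      (ha.finiteBorel_truncatedTrawlSetAt _ _) (truncatedTrawlSetAt_subset _ _ _),
      volume_real_sdiff_truncated]
    exact hTε

theorem tendstoInMeasure_average_trawl_mul (hM : IsCenteredNoise volume P M)
    (ha : IsTrawlFunction a) (hΔpos : ∀ n, 0 < Δ n)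
    (hnΔ : Tendsto (fun n : ℕ => (n : ℝ) * Δ n) atTop atTop)
    {c : ℕ → ℕ} (hc : ∀ n, c n ≤ n) {s : ℕ → ℝ} (hs0 : ∀ n, 0 ≤ s n) {S : ℝ}
    (hS : ∀ᶠ n in atTop, s n ≤ S) :
    TendstoInMeasure P (fun (n : ℕ) ω => (1 / (n : ℝ)) * ∑ k ∈ Finset.range (c n),
      (M (trawlSetAt a (k * Δ n + s n)) ω * M (trawlSetAt a (k * Δ n)) ω
        - volume.real (trawlTail a (s n)))) atTop (fun _ => 0) := by
  have fA := ha.finiteBorel_trawlSetAt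
  have iA : ∀ t u, Integrable (fun ω => M (trawlSetAt a t) ω * M (trawlSetAt a u) ω) P :=
    fun t u => (hM.memLp_two_mul (fA t) (fA u)).integrable (by norm_num)
  refine tendstoInMeasure_average hΔpos hnΔ hc
    (fun n k => (iA _ _).sub (integrable_const _)) fun ε hε => ?_
  set G0 := volume.real (trawlSet a) with hG0
  -- Truncating the product costs at most `2√G0` times the root of the tail area, and recentring it
  -- costs as much again, hence `4√G0`; the `+ 1` keeps the denominator positive.
  obtain ⟨T, hT, hTε⟩ := ha.exists_sqrt_volume_real_trawlTail_le
    (show 0 < ε / (4 * √G0 + 1) by positivity)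
  have fB := ha.finiteBorel_truncatedTrawlSetAt T
  have mB : ∀ t u, MemLp (fun ω => M (truncatedTrawlSetAt a T t) ω
      * M (truncatedTrawlSetAt a T u) ω) 2 P := fun t u => hM.memLp_two_mul (fB t) (fB u)
  have iB := fun t u => (mB t u).integrable (by norm_num)
  have hS0 : 0 ≤ S := by
    obtain ⟨n, hn⟩ := hS.exists
    exact (hs0 n).trans hn
  -- The two cut sets at index `k` lie over times from `kΔ - T` to `kΔ + s`, so pairs of sets
  -- separate once the time lag exceeds `T + S`. All cut sets have equal area, so one fourth moment
  -- bounds every second moment of a product.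
  refine ⟨T + S, ∫ ω, M (truncatedTrawlSetAt a T 0) ω ^ 4 ∂P, by positivity,
    integral_nonneg fun ω => by positivity, hS.mono fun n hn =>
    ⟨fun k ω => M (truncatedTrawlSetAt a T (k * Δ n + s n)) ω
      * M (truncatedTrawlSetAt a T (k * Δ n)) ω
      - ∫ ω', M (truncatedTrawlSetAt a T (k * Δ n + s n)) ω'
      * M (truncatedTrawlSetAt a T (k * Δ n)) ω' ∂P,
      fun k => (mB _ _).sub (memLp_const _), fun k => ?_, fun j k hjk => ?_,
      fun k => ?_⟩⟩
  · rw [← variance_eq_integral (mB _ _).aemeasurable]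
    refine (variance_le_expectation_sq (mB _ _).1).trans ?_
    refine (hM.integral_mul_sq_le (fB _) (fB _)).trans (le_of_eq ?_)
    rw [hM.integral_pow_four _ _ (fB (k * Δ n + s n)) (fB 0)
      (by rw [ha.volume_real_truncated, ha.volume_real_truncated]),
      hM.integral_pow_four _ _ (fB (k * Δ n)) (fB 0)
      (by rw [ha.volume_real_truncated, ha.volume_real_truncated])]
    ring
  -- The integral of two centred products is their covariance by definition.
  · refine hM.covariance_mul_mul_eq_zero (fB _) (fB _) (fB _) (fB _) ?_
    have hs := hs0 n
    rw [Set.disjoint_union_left, Set.disjoint_union_right, Set.disjoint_union_right]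
    have key : ∀ t u, t + T ≤ u →
        Disjoint (truncatedTrawlSetAt a T t) (truncatedTrawlSetAt a T u) := fun t u htu =>
      (disjoint_truncatedTrawlSetAt a htu).mono_left (truncatedTrawlSetAt_subset a T _)
    refine ⟨⟨key _ _ ?_, key _ _ ?_⟩, key _ _ ?_, key _ _ ?_⟩ <;> linarith
  · set t := (k : ℝ) * Δ n
    have hmain := hM.integral_abs_mul_sub_mul_le (fA (t + s n)) (fA t) (fB (t + s n)) (fB t)
      (truncatedTrawlSetAt_subset _ _ _) (truncatedTrawlSetAt_subset _ _ _)
    rw [volume_real_sdiff_truncated, volume_real_sdiff_truncated, measureReal_def,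
      measureReal_def (s := trawlSetAt a t), volume_trawlSetAt, volume_trawlSetAt,
      ← measureReal_def, ← hG0] at hmain
    have hG : volume.real (trawlTail a (s n))
        = ∫ ω, M (trawlSetAt a (t + s n)) ω * M (trawlSetAt a t) ω ∂P := by
      rw [hM.integral_mul (fA _) (fA _), Set.inter_comm,
        ha.volume_real_inter (by linarith [hs0 n]), add_sub_cancel_left]
    have hd : Integrable (fun ω => M (trawlSetAt a (t + s n)) ω * M (trawlSetAt a t) ω
        - M (truncatedTrawlSetAt a T (t + s n)) ω * M (truncatedTrawlSetAt a T t) ω) P :=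
      (iA _ _).sub (iB _ _)
    have hmean := abs_integral_le_integral_abs (μ := P) (f := fun ω =>
      M (trawlSetAt a (t + s n)) ω * M (trawlSetAt a t) ω
        - M (truncatedTrawlSetAt a T (t + s n)) ω * M (truncatedTrawlSetAt a T t) ω)
    rw [integral_sub (iA _ _) (iB _ _), ← hG] at hmean
    set I := ∫ ω, M (truncatedTrawlSetAt a T (t + s n)) ω * M (truncatedTrawlSetAt a T t) ω ∂P
    have hfin : 4 * √G0 * (ε / (4 * √G0 + 1)) ≤ ε := by
      rw [mul_div_assoc', div_le_iff₀ (by positivity)]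
      nlinarith [Real.sqrt_nonneg G0]
    have hmul := mul_le_mul_of_nonneg_left hTε (by positivity : 0 ≤ 4 * √G0)
    calc _ ≤ ∫ ω, (|M (trawlSetAt a (t + s n)) ω * M (trawlSetAt a t) ω
          - M (truncatedTrawlSetAt a T (t + s n)) ω * M (truncatedTrawlSetAt a T t) ω|
          + |volume.real (trawlTail a (s n)) - I|) ∂P := by
          refine integral_mono (((iA _ _).sub (integrable_const _)).sub
            ((iB _ _).sub (integrable_const _))).abs (hd.abs.add (integrable_const _))
            fun ω => ?_
          refine le_trans (le_of_eq ?_) (abs_sub _ _)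
          congr 1
          ring
      _ ≤ ε := by
          rw [integral_add hd.abs (integrable_const _), integral_const, probReal_univ, one_smul]
          linarith

theorem tendstoInMeasure_sampleAutocov (hM : IsCenteredNoise volume P M)
    (ha : IsTrawlFunction a) (hΔpos : ∀ n, 0 < Δ n)
    (hnΔ : Tendsto (fun n : ℕ => (n : ℝ) * Δ n) atTop atTop) (μ : ℝ) {l : ℕ → ℕ} {h : ℝ}
    (hh : 0 ≤ h) (hlh : ∀ n, h ≤ l n * Δ n)
    (hl : Tendsto (fun n => (l n : ℝ) * Δ n) atTop (𝓝 h)) :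
    TendstoInMeasure P (fun (n : ℕ) ω => sampleAutocov (fun t => M (trawlSetAt a t) ω + μ)
      (Δ n) n (l n)) atTop (fun _ => volume.real (trawlTail a h)) := by
  have hprod := hM.tendstoInMeasure_average_trawl_mul ha hΔpos hnΔ (c := fun n => n - l n)
    (fun n => Nat.sub_le _ _) (s := fun n => l n * Δ n)
    (fun n => mul_nonneg (Nat.cast_nonneg _) (hΔpos n).le)
    -- The lags converge to `h`, hence are eventually at most `h + 1`.
    (hl.eventually_le_const (lt_add_one h))
  have hmean0 := hM.tendstoInMeasure_average_trawl ha hΔpos hnΔ (c := fun n => n)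
    (fun n => le_rfl) (fun _ => 0)
  have hmean1 := hM.tendstoInMeasure_average_trawl ha hΔpos hnΔ (c := fun n => n - l n)
    (fun n => Nat.sub_le _ _) (fun n => l n * Δ n)
  have hmean2 := hM.tendstoInMeasure_average_trawl ha hΔpos hnΔ (c := fun n => n - l n)
    (fun n => Nat.sub_le _ _) (fun _ => 0)
  simp only [add_zero] at hmean0 hmean2
  have hratio := tendsto_sub_div_of_mul_tendsto hΔpos hnΔ hl
  have hG := ha.tendsto_volume_real_trawlTail hlh hh hl
  have hdet := TendstoInMeasure.of_tendsto (P := P) (hG.mul hratio)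
  have hr := TendstoInMeasure.of_tendsto (P := P) hratio
  have hall := ((hprod.add_const_limits hdet).sub_const_limits
    (hmean0.mul_const_limits (hmean1.add_const_limits hmean2))).add_const_limits
    (hr.mul_const_limits (hmean0.mul_const_limits hmean0))
  simp only [mul_one, zero_add, mul_zero, sub_zero, add_zero] at hall
  refine hall.congr_left fun n => ae_of_all _ fun ω => ?_
  exact (sampleAutocov_add_const (fun t => M (trawlSetAt a t) ω) μ _ (Δ n) n (l n)).symm

/-- The sum is nonnegative, so its `L¹` norm is its mean. This is at most the area lost by `A` under
a shift of `Δ n`, which tends to zero; no law of large numbers is needed. -/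
theorem tendstoInMeasure_quadraticVariation (hM : IsCenteredNoise volume P M)
    (ha : IsTrawlFunction a) (hΔpos : ∀ n, 0 < Δ n) (hΔ : Tendsto Δ atTop (𝓝 0)) :
    TendstoInMeasure P (fun (n : ℕ) ω => (1 / (2 * (n : ℝ))) * ∑ k ∈ Finset.range (n - 1),
      (M (trawlSetAt a (((k + 1 : ℕ) : ℝ) * Δ n)) ω - M (trawlSetAt a (k * Δ n)) ω) ^ 2) atTop
      (fun _ => 0) := by
  have fA := ha.finiteBorel_trawlSetAt
  have hi : ∀ s t, Integrable (fun ω => (M (trawlSetAt a s) ω - M (trawlSetAt a t) ω) ^ 2) P :=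
    fun s t => ((hM.memLp_two (fA s)).sub (hM.memLp_two (fA t))).integrable_sq
  refine TendstoInMeasure.of_tendsto_integral_abs
    (fun n => (integrable_finsetSum _ fun k _ => hi _ _).const_mul _) ?_
  have hG := ha.tendsto_volume_real_trawlTail (fun n => (hΔpos n).le) le_rfl hΔ
  have hG' := hG.const_sub (volume.real (trawlTail a 0))
  rw [sub_self] at hG'
  refine tendsto_of_tendsto_of_tendsto_of_le_of_le tendsto_const_nhds hG'
    (fun n => integral_nonneg fun ω => abs_nonneg _) fun n => ?_
  have hnn : 0 ≤ volume.real (trawlTail a 0) - volume.real (trawlTail a (Δ n)) :=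
    (ha.volume_real_trawlTail_sub le_rfl (hΔpos n).le).1
  have habs : ∀ ω, |(1 / (2 * (n : ℝ))) * ∑ k ∈ Finset.range (n - 1),
      (M (trawlSetAt a (((k + 1 : ℕ) : ℝ) * Δ n)) ω - M (trawlSetAt a (k * Δ n)) ω) ^ 2|
      = (1 / (2 * (n : ℝ))) * ∑ k ∈ Finset.range (n - 1),
      (M (trawlSetAt a (((k + 1 : ℕ) : ℝ) * Δ n)) ω - M (trawlSetAt a (k * Δ n)) ω) ^ 2 :=
    fun ω => abs_of_nonneg
      (mul_nonneg (by positivity) (Finset.sum_nonneg fun k _ => sq_nonneg _))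
  simp only
  simp_rw [habs]
  rw [integral_const_mul, integral_finsetSum _ fun k _ => hi _ _]
  have hterm : ∀ k : ℕ, ∫ ω, (M (trawlSetAt a (((k + 1 : ℕ) : ℝ) * Δ n)) ω
      - M (trawlSetAt a (k * Δ n)) ω) ^ 2 ∂P
      = 2 * (volume.real (trawlTail a 0) - volume.real (trawlTail a (Δ n))) := fun k => by
    have hk : ((k + 1 : ℕ) : ℝ) * Δ n = k * Δ n + Δ n := by push_cast; ring
    rw [hM.integral_sub_sq (fA _) (fA _), Set.inter_comm, hk,
      ha.volume_real_inter (by linarith [hΔpos n]), add_sub_cancel_left, trawlTail_zero,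
      measureReal_def, measureReal_def (s := trawlSetAt a (k * Δ n)), volume_trawlSetAt,
      volume_trawlSetAt, ← measureReal_def]
    ring
  simp_rw [hterm]
  rw [Finset.sum_const, Finset.card_range, nsmul_eq_mul]
  rcases Nat.eq_zero_or_pos n with rfl | hn
  · simpa using hnn
  have hn' : (0 : ℝ) < n := by exact_mod_cast hn
  have hn1 : ((n - 1 : ℕ) : ℝ) ≤ n := by exact_mod_cast Nat.sub_le _ _
  set g := volume.real (trawlTail a 0) - volume.real (trawlTail a (Δ n))
  calc (1 / (2 * (n : ℝ))) * (((n - 1 : ℕ) : ℝ) * (2 * g))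
      ≤ (1 / (2 * (n : ℝ))) * ((n : ℝ) * (2 * g)) := by gcongr
    _ = g := by field_simp

end IsCenteredNoise

/-! ### Telescoping of the estimators -/

section Telescoping

variable {X : ℝ → ℝ} {Δ : ℝ}

theorem trawlEstimator_mul_of_pos (hΔ : 0 < Δ) {n l : ℕ} (hl : 0 < l) :
    trawlEstimator X Δ n (l * Δ) * Δ = sampleAutocov X Δ n l - sampleAutocov X Δ n (l + 1) := by
  have hl' : (l : ℝ) * Δ ≠ 0 := by positivity
  rw [trawlEstimator, if_neg hl', mul_div_cancel_right₀ _ hΔ.ne', Nat.floor_natCast]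
  field_simp
  ring

theorem sampleAutocov_of_le {n l : ℕ} (h : n ≤ l) : sampleAutocov X Δ n l = 0 := by
  simp [sampleAutocov, Nat.sub_eq_zero_of_le h]

/-- Only the lower boundary term survives, as the autocovariance vanishes at lag `n`. The start `c`
must be positive because the estimator at time zero has a different form. -/
theorem sum_Ico_trawlEstimator_mul (hΔ : 0 < Δ) {n c : ℕ} (hc : 0 < c) :
    ∑ l ∈ Finset.Ico c n, trawlEstimator X Δ n (l * Δ) * Δ = sampleAutocov X Δ n c := by
  rcases le_total n c with h | h
  · rw [Finset.Ico_eq_empty_of_le h, Finset.sum_empty, sampleAutocov_of_le h]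
  · have h1 : ∀ l ∈ Finset.Ico c n, trawlEstimator X Δ n (l * Δ) * Δ
        = sampleAutocov X Δ n l - sampleAutocov X Δ n (l + 1) := fun l hl =>
      trawlEstimator_mul_of_pos hΔ (hc.trans_le (Finset.mem_Ico.1 hl).1)
    rw [Finset.sum_congr rfl h1, Finset.sum_Ico_eq_sum_range]
    have h2 := Finset.sum_range_sub' (fun i => sampleAutocov X Δ n (c + i)) (n - c)
    simp only [add_zero, ← add_assoc] at h2
    rw [h2, Nat.add_sub_of_le h, sampleAutocov_of_le le_rfl, sub_zero]

theorem lebEstimator_eq (hΔ : 0 < Δ) (n : ℕ) :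
    lebEstimator X Δ n = (1 / (2 * (n : ℝ))) * ∑ k ∈ Finset.range (n - 1),
      (X (((k + 1 : ℕ) : ℝ) * Δ) - X (k * Δ)) ^ 2 + sampleAutocov X Δ n 1 := by
  rcases Nat.eq_zero_or_pos n with rfl | hn
  · simp [lebEstimator, sampleAutocov]
  · rw [lebEstimator, Finset.range_eq_Ico, Finset.sum_eq_sum_Ico_succ_bot hn, zero_add,
      sum_Ico_trawlEstimator_mul hΔ one_pos, trawlEstimator, if_pos (by simp)]
    congr 1
    have hn' : (n : ℝ) ≠ 0 := by exact_mod_cast hn.ne'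
    have := hΔ.ne'
    rw [mul_right_comm]
    congr 1
    field_simp

theorem lebInterEstimator_eq (hΔ : 0 < Δ) (n : ℕ) {h : ℝ} (hh : 0 < h) :
    lebInterEstimator X Δ n h = sampleAutocov X Δ n ⌈h / Δ⌉₊ := by
  classical
  rw [← sum_Ico_trawlEstimator_mul hΔ (Nat.ceil_pos.2 (div_pos hh hΔ)), lebInterEstimator]
  refine Finset.sum_congr ?_ fun _ _ => rfl
  ext l
  rw [Finset.mem_filter, Finset.mem_range, Finset.mem_Ico, Nat.ceil_le, div_le_iff₀ hΔ, and_comm]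

theorem lebDiffEstimator_eq (n : ℕ) (h : ℝ) :
    lebDiffEstimator X Δ n h = lebEstimator X Δ n - lebInterEstimator X Δ n h := by
  classical
  rw [eq_sub_iff_add_eq', lebEstimator, lebInterEstimator, lebDiffEstimator,
    ← Finset.sum_filter_add_sum_filter_not (Finset.range n) (fun l : ℕ => h ≤ l * Δ)]
  simp only [not_le]

end Telescoping

/-! ### The three limits -/

theorem tendsto_ceil_div_mul {Δ : ℕ → ℝ} (hΔpos : ∀ n, 0 < Δ n) (hΔ : Tendsto Δ atTop (𝓝 0))
    {h : ℝ} (hh : 0 < h) : (∀ n, h ≤ ⌈h / Δ n⌉₊ * Δ n) ∧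
      Tendsto (fun n => (⌈h / Δ n⌉₊ : ℝ) * Δ n) atTop (𝓝 h) := by
  have hle : ∀ n, h ≤ ⌈h / Δ n⌉₊ * Δ n := fun n => (div_le_iff₀ (hΔpos n)).1 (Nat.le_ceil _)
  have h1 : Tendsto (fun n => h + Δ n) atTop (𝓝 h) := by simpa using hΔ.const_add h
  refine ⟨hle, tendsto_of_tendsto_of_tendsto_of_le_of_le tendsto_const_nhds h1 hle fun n => ?_⟩
  have e := (Nat.ceil_lt_add_one (div_pos hh (hΔpos n)).le).le
  have e2 := mul_le_mul_of_nonneg_right e (hΔpos n).le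
  rwa [add_mul, div_mul_cancel₀ _ (hΔpos n).ne', one_mul] at e2

theorem mainTheorem8
    {Ω Ω' : Type*} [MeasurableSpace Ω] [MeasurableSpace Ω']
    (P : Measure Ω) [IsProbabilityMeasure P] (P' : Measure Ω') [IsProbabilityMeasure P']
    (γ b : ℝ) (hb : 0 ≤ b) (ν : Measure ℝ) (hν : IsLevyMeasure ν)
    (L : Set (ℝ × ℝ) → Ω → ℝ) (hL : IsHomogeneousLevyBasis γ b ν P L)
    (L' : Ω' → ℝ) (hL' : IsLevySeed γ b ν P' L')
    (hmoment : Integrable (fun ω => |L' ω| ^ 4) P') (hvar : variance L' P' = 1)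
    (a : ℝ → ℝ) (ha : IsTrawlFunction a)
    (Δ : ℕ → ℝ) (hΔpos : ∀ n, 0 < Δ n) (hΔ : Tendsto Δ atTop (𝓝 0))
    (hnΔ : Tendsto (fun n : ℕ => (n : ℝ) * Δ n) atTop atTop) :
    ∀ h : ℝ, 0 < h →
      TendstoInMeasure P
        (fun (n : ℕ) ω => lebEstimator (fun t => trawlProcess L a t ω) (Δ n) n) atTop
        (fun _ => volume.real (trawlSet a)) ∧
      TendstoInMeasure P
        (fun (n : ℕ) ω => lebInterEstimator (fun t => trawlProcess L a t ω) (Δ n) n h) atTop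
        (fun _ => volume.real (trawlSet a ∩ trawlSetAt a h)) ∧
      TendstoInMeasure P
        (fun (n : ℕ) ω => lebDiffEstimator (fun t => trawlProcess L a t ω) (Δ n) n h) atTop
        (fun _ => volume.real (trawlSet a \ trawlSetAt a h)) := by
  intro h hh
  have hM := hL.isCenteredNoise hL' hmoment hvar
  set M : Set (ℝ × ℝ) → Ω → ℝ := fun A ω => L A ω - ∫ ω', L A ω' ∂P with hMdef
  -- All trawl sets have the same area, so the mean of the process does not depend on time.
  have hX : ∀ ω, (fun t => trawlProcess L a t ω)
      = fun t => M (trawlSetAt a t) ω + ∫ ω', L (trawlSetAt a 0) ω' ∂P := fun ω => by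
    ext t
    have := (hL.identDistrib (ha.finiteBorel_trawlSetAt t) (ha.finiteBorel_trawlSetAt 0)
      (by rw [measureReal_def, measureReal_def, volume_trawlSetAt, volume_trawlSetAt])).integral_eq
    rw [hMdef, trawlProcess, ← this, sub_add_cancel]
  obtain ⟨hle, hlim⟩ := tendsto_ceil_div_mul hΔpos hΔ hh
  have hinter : TendstoInMeasure P
      (fun (n : ℕ) ω => lebInterEstimator (fun t => trawlProcess L a t ω) (Δ n) n h) atTop
      (fun _ => volume.real (trawlSet a ∩ trawlSetAt a h)) := by
    have hG : volume.real (trawlSet a ∩ trawlSetAt a h) = volume.real (trawlTail a h) := by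
      rw [← trawlSetAt_zero, ha.volume_real_inter hh.le, sub_zero]
    rw [hG]
    refine (hM.tendstoInMeasure_sampleAutocov ha hΔpos hnΔ (∫ ω', L (trawlSetAt a 0) ω' ∂P)
      hh.le hle hlim).congr_left fun n => ae_of_all _ fun ω => ?_
    beta_reduce
    rw [lebInterEstimator_eq (hΔpos n) n hh, hX]
  have hleb : TendstoInMeasure P
      (fun (n : ℕ) ω => lebEstimator (fun t => trawlProcess L a t ω) (Δ n) n) atTop
      (fun _ => volume.real (trawlSet a)) := by
    -- Lag one corresponds to the time `Δ n`, which tends to `0`, so the limit is the whole area of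
    -- `A`.
    have hone := hM.tendstoInMeasure_sampleAutocov ha hΔpos hnΔ
      (∫ ω', L (trawlSetAt a 0) ω' ∂P) (l := fun _ => 1) le_rfl
      (fun n => by simpa using (hΔpos n).le) (by simpa using hΔ)
    have hadd := (hM.tendstoInMeasure_quadraticVariation ha hΔpos hΔ).add_const_limits hone
    rw [zero_add, trawlTail_zero] at hadd
    refine hadd.congr_left fun n => ae_of_all _ fun ω => ?_
    beta_reduce
    rw [hX, lebEstimator_eq (hΔpos n)]
    simp only [add_sub_add_right_eq_sub]
  refine ⟨hleb, hinter, ?_⟩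
  have hvol : volume.real (trawlSet a \ trawlSetAt a h)
      = volume.real (trawlSet a) - volume.real (trawlSet a ∩ trawlSetAt a h) := by
    rw [← measureReal_sdiff_add_inter (μ := volume) (s := trawlSet a)
      (ha.measurableSet_trawlSetAt h) ha.volume_trawlSet_lt_top.ne, add_sub_cancel_right]
  rw [hvol]
  refine (hleb.sub_const_limits hinter).congr_left fun n => ae_of_all _ fun ω => ?_
  beta_reduce
  rw [lebDiffEstimator_eq]
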